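/- A binary-action polymatrix game consists of a finite simple graph $G$ whose vertices are the players, and, for each edge $ij$, two rational $2\times 2$ matrices $\Pi^{ij}$ and $\Pi^{ji}$, where $\Pi^{ij}_{ab}$ is the payoff of player $i$ from the interaction with $j$ when $i$ plays action $a$ and $j$ plays action $b$ ($a,b\in\{1,2\}$). A strategy profile $s$ assigns an action $s_i$ to every player $i$, and the payoff of player $i$ is $p_i(s)=\sum_{j:\,ij\in E(G)}\Pi^{ij}_{s_is_j}$. The game is pure-coordination if for each edge $ij$ the profiles $(1,1)$ and $(2,2)$ are Nash equilibria of the two-player game $(\Pi^{ij},\Pi^{ji})$. It is pairwise-potential if for each edge $uv$ the two-player game $(\Pi^{uv},\Pi^{vu})$ has a potential, that is, a real matrix $\Phi^{uv}$ with $\Phi^{uv}_{ab}-\Phi^{uv}_{a'b}=\Pi^{uv}_{ab}-\Pi^{uv}_{a'b}$ and $\Phi^{uv}_{ab}-\Phi^{uv}_{ab'}=\Pi^{vu}_{ba}-\Pi^{vu}_{b'a}$ for all actions $a,a',b,b'$. There is an algorithm which, given a pairwise-potential pure-coordination binary-action polymatrix game, finds, in time polynomial in the bit length of the input, a strategy profile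 that maximizes the potential $\Phi(s)=\sum_{uv\in E(G)}\Phi^{uv}_{s_us_v}$. The profile found maximizes $\Phi$ for every choice of the pairwise potentials $\Phi^{uv}$, and it maximizes every potential function of the game, that is, every real-valued function $\Psi$ of the strategy profiles such that $\Psi(s')-\Psi(s)=p_i(s')-p_i(s)$ for every player $i$ and all profiles $s,s'$ that differ at most in the action of $i$. -/

import Mathlib

/-! ### Machine model: array programs over the integers with logarithmic (bit) cost

This is the random access machine with logarithmic cost, with structured control flow.  The memory
consists of integer arrays; the array names are fixed by the program and the indices are computed at
run time.  Every integer that occurs during the computation (constants, indices, values read, results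
of arithmetic operations) is charged its bit length, so that, as for the usual random access machine
with logarithmic cost, polynomial cost is the same as polynomial time on a Turing machine. -/

namespace ArrayRAM

/-- The number of bits used to write an integer: a sign and its binary digits. -/
def bitLength (z : ℤ) : ℕ := Nat.size z.natAbs + 1

/-- The memory: `σ a i` is the content of the cell with index `i` of the array `a`. -/
abbrev Memory : Type := ℕ → ℤ → ℤ

/-- The arithmetic instructions. -/
inductive Op : Type
  | add
  | sub
  | mul
  | div

/-- The value of an arithmetic instruction (`div` is integer division, with `x / 0 = 0`). -/
def Op.apply : Op → ℤ → ℤ → ℤ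
  | .add, x, y => x + y
  | .sub, x, y => x - y
  | .mul, x, y => x * y
  | .div, x, y => x / y

/-- Expressions: constants, array accesses, arithmetic. -/
inductive Expr : Type
  | const (z : ℤ)
  | read (a : ℕ) (i : Expr)
  | op (o : Op) (e₁ e₂ : Expr)

/-- The value of an expression in a given memory. -/
def Expr.eval (σ : Memory) : Expr → ℤ
  | .const z => z
  | .read a i => σ a (i.eval σ)
  | .op o e₁ e₂ => o.apply (e₁.eval σ) (e₂.eval σ)

/-- The cost of evaluating an expression: the bit lengths of all the values computed on the way. -/
def Expr.cost (σ : Memory) : Expr → ℕ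
  | .const z => bitLength z
  | .read a i => i.cost σ + bitLength (σ a (i.eval σ))
  | .op o e₁ e₂ => e₁.cost σ + e₂.cost σ + bitLength (o.apply (e₁.eval σ) (e₂.eval σ))

/-- Programs.  `write a i e` stores the value of `e` in the cell with index `i` of the array `a`;
the tests of `ite` and `loop` ask whether the value of `e` is positive. -/
inductive Program : Type
  | skip
  | write (a : ℕ) (i e : Expr)
  | seq (c₁ c₂ : Program)
  | ite (e : Expr) (c₁ c₂ : Program)
  | loop (e : Expr) (c : Program)

/-- The memory after storing `v` in the cell with index `i` of the array `a`. -/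
def Memory.store (σ : Memory) (a : ℕ) (i v : ℤ) : Memory :=
  Function.update σ a (Function.update (σ a) i v)

/-- `Exec c σ t σ'`: the program `c`, started in the memory `σ`, halts in the memory `σ'`, and the
total cost of the run is `t`. -/
inductive Exec : Program → Memory → ℕ → Memory → Prop
  | skip (σ : Memory) : Exec .skip σ 1 σ
  | write (σ : Memory) (a : ℕ) (i e : Expr) :
      Exec (.write a i e) σ (1 + i.cost σ + e.cost σ) (σ.store a (i.eval σ) (e.eval σ))
  | seq {σ σ' σ'' : Memory} {c₁ c₂ : Program} {t₁ t₂ : ℕ} :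
      Exec c₁ σ t₁ σ' → Exec c₂ σ' t₂ σ'' → Exec (.seq c₁ c₂) σ (t₁ + t₂) σ''
  | ite_pos {σ σ' : Memory} {e : Expr} {c₁ c₂ : Program} {t : ℕ} :
      0 < e.eval σ → Exec c₁ σ t σ' → Exec (.ite e c₁ c₂) σ (1 + e.cost σ + t) σ'
  | ite_neg {σ σ' : Memory} {e : Expr} {c₁ c₂ : Program} {t : ℕ} :
      e.eval σ ≤ 0 → Exec c₂ σ t σ' → Exec (.ite e c₁ c₂) σ (1 + e.cost σ + t) σ'
  | loop_step {σ σ' σ'' : Memory} {e : Expr} {c : Program} {t₁ t₂ : ℕ} :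
      0 < e.eval σ → Exec c σ t₁ σ' → Exec (.loop e c) σ' t₂ σ'' →
      Exec (.loop e c) σ (1 + e.cost σ + t₁ + t₂) σ''
  | loop_done {σ : Memory} {e : Expr} {c : Program} :
      e.eval σ ≤ 0 → Exec (.loop e c) σ (1 + e.cost σ) σ

/-- The initial memory on an input list: the list is in array `0`, its length is in cell `0` of array
`1`, and all other cells are `0`. -/
def initial (l : List ℤ) : Memory := fun a i =>
  if a = 0 ∧ 0 ≤ i then l.getD i.toNat 0
  else if a = 1 ∧ i = 0 then l.length
  else 0

/-- The output list, read by the same convention: array `0` from index `0` on, of the length stored in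
cell `0` of array `1`. -/
def output (σ : Memory) : List ℤ :=
  (List.range (σ 1 0).toNat).map fun i : ℕ => σ 0 (i : ℤ)

/-- `Computes c x t y`: on input `x`, the program `c` halts at total cost `t` with output `y`. -/
def Computes (c : Program) (x : List ℤ) (t : ℕ) (y : List ℤ) : Prop :=
  ∃ σ : Memory, Exec c (initial x) t σ ∧ output σ = y

/-- The size of an input in bits. -/
def inputSize (x : List ℤ) : ℕ := (x.map bitLength).sum

end ArrayRAM

/-! ### Binary-action polymatrix games -/

/-- A binary-action polymatrix game with rational payoffs.  The action `one` is `0 : Fin 2` and `two`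
is `1 : Fin 2`.  For an edge `ij`, the entry `payoff i j a b` of the matrix `Π^{ij}` is what player `i`
receives from the interaction with `j` if `i` plays `a` and `j` plays `b`; the values of `payoff` at
pairs that are not edges are never used. -/
structure BinaryPolymatrixGame : Type where
  /-- The number of players. -/
  n : ℕ
  /-- The underlying graph. -/
  graph : SimpleGraph (Fin n)
  /-- The payoff matrices. -/
  payoff : Fin n → Fin n → Matrix (Fin 2) (Fin 2) ℚ

namespace BinaryPolymatrixGame

/-- Pure strategy profiles. -/
abbrev Profile (G : BinaryPolymatrixGame) : Type := Fin G.n → Fin 2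

open Classical in
/-- The payoff of player `i`: the sum of the payoffs from the interactions with all neighbours. -/
noncomputable def totalPayoff (G : BinaryPolymatrixGame) (i : Fin G.n) (s : G.Profile) : ℚ :=
  ∑ j, if G.graph.Adj i j then G.payoff i j (s i) (s j) else 0

/-- `(a, b)` is a pure Nash equilibrium of the two-player game `(A, B)`.  Each matrix has its own
player's action as row index. -/
def IsTwoPlayerNash (A B : Matrix (Fin 2) (Fin 2) ℚ) (a b : Fin 2) : Prop :=
  (∀ a', A a' b ≤ A a b) ∧ (∀ b', B b' a ≤ B b a)

/-- The game is pure-coordination: on every edge, `(one, one)` and `(two, two)` are Nash equilibria of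
the two-player game. -/
def IsPureCoordination (G : BinaryPolymatrixGame) : Prop :=
  ∀ i j, G.graph.Adj i j →
    IsTwoPlayerNash (G.payoff i j) (G.payoff j i) 0 0 ∧
    IsTwoPlayerNash (G.payoff i j) (G.payoff j i) 1 1

/-- `φ` is a potential of the two-player game `(A, B)`; the row index of `φ` is the action of the first
player and the column index is the action of the second player. -/
def IsTwoPlayerPotential (A B : Matrix (Fin 2) (Fin 2) ℚ) (φ : Matrix (Fin 2) (Fin 2) ℝ) : Prop :=
  (∀ a a' b, φ a b - φ a' b = (A a b : ℝ) - (A a' b : ℝ)) ∧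
  (∀ a b b', φ a b - φ a b' = (B b a : ℝ) - (B b' a : ℝ))

/-- The game is pairwise-potential: the two-player game on every edge has a potential. -/
def IsPairwisePotential (G : BinaryPolymatrixGame) : Prop :=
  ∀ i j, G.graph.Adj i j → ∃ φ, IsTwoPlayerPotential (G.payoff i j) (G.payoff j i) φ

/-- `φ` is a choice of pairwise potentials: `φ i j` is a potential of the two-player game on every edge
`ij`, where the endpoint `i < j` is the row player. -/
def IsPotentialFamily (G : BinaryPolymatrixGame)
    (φ : Fin G.n → Fin G.n → Matrix (Fin 2) (Fin 2) ℝ) : Prop :=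
  ∀ i j, i < j → G.graph.Adj i j → IsTwoPlayerPotential (G.payoff i j) (G.payoff j i) (φ i j)

open Classical in
/-- The sum of the pairwise potentials over all edges; each edge is counted once. -/
noncomputable def potentialSum (G : BinaryPolymatrixGame)
    (φ : Fin G.n → Fin G.n → Matrix (Fin 2) (Fin 2) ℝ) (s : G.Profile) : ℝ :=
  ∑ i, ∑ j, if i < j ∧ G.graph.Adj i j then φ i j (s i) (s j) else 0

/-- `Φ` is a potential function of the whole game: for each unilateral deviation, the change of `Φ` is
the change of the payoff of the deviating player. -/
def IsPotential (G : BinaryPolymatrixGame) (Φ : G.Profile → ℝ) : Prop :=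
  ∀ (i : Fin G.n) (s : G.Profile) (a a' : Fin 2),
    Φ (Function.update s i a) - Φ (Function.update s i a') =
      (G.totalPayoff i (Function.update s i a) : ℝ) -
        (G.totalPayoff i (Function.update s i a') : ℝ)

/-- A rational number, written as numerator and denominator in lowest terms. -/
def encodeRat (q : ℚ) : List ℤ := [q.num, (q.den : ℤ)]

/-- The four entries of a payoff matrix, row by row. -/
def encodeMatrix (A : Matrix (Fin 2) (Fin 2) ℚ) : List ℤ :=
  encodeRat (A 0 0) ++ encodeRat (A 0 1) ++ encodeRat (A 1 0) ++ encodeRat (A 1 1)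

open Classical in
/-- The game as an input: the number of players and then, for all ordered pairs `(i, j)` of players in
lexicographic order, the entry of the adjacency matrix, followed by the payoff matrix `Π^{ij}` (replaced
by zeros if `ij` is not an edge). -/
noncomputable def encode (G : BinaryPolymatrixGame) : List ℤ :=
  (G.n : ℤ) :: (List.finRange G.n).flatMap fun i => (List.finRange G.n).flatMap fun j =>
    if G.graph.Adj i j then 1 :: encodeMatrix (G.payoff i j) else 0 :: encodeMatrix 0

/-- A strategy profile as an output: the list of the actions of the players. -/
def encodeProfile (G : BinaryPolymatrixGame) (s : G.Profile) : List ℤ :=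
  List.ofFn fun i => ((s i : ℕ) : ℤ)

end BinaryPolymatrixGame

/-! The problem is a minimum cut problem. For an ordered pair `ij`, let `y` be what player `i` loses
on the edge by leaving `(1, 1)`, and `z` what it loses by leaving `(2, 2)`. Pure coordination makes
both nonnegative. A pairwise potential forces the sum `y + z` to be the same for `ij` and `ji`
(`IsPairwisePotential.loss_symm`). Add a source and a sink to the players, and let each ordered pair
contribute capacity `y + z` to the arc from `i` to `j`, `y` to the arc from `i` to the sink and `z`
to the arc from the source to `i`. Put the players with action two on the source side. If one player
switches, the cut value changes by minus twice the change of that player's payoff, so the cut value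
plus `2Φ` is constant for every potential `Φ` of the game (`IsPotential.cut_eq`). A minimum cut
therefore maximizes all potentials at once, and none has to be computed. The sum of pairwise
potentials is one of them (`IsPotentialFamily.isPotential`).

Multiplication by the product `D` of all denominators makes the capacities integral, and `D` is no
longer than the input. The minimum cut is found by capacity scaling. Flows are never mentioned:
moving one scale unit `Δ` along a path of residual arcs lowers every cut between source and sink by
exactly `Δ` (`walk_spec`), so residual and initial cut values differ by one constant. If no path of
arcs of capacity at least `Δ` is left, the vertices that cannot reach the sink form a cut all of
whose arcs are below `Δ`. This allows at most `2N²` augmentations after `Δ` is halved (`N`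
vertices), and for `Δ = 1` it makes the residual cut vanish, hence the cut minimum
(`phaseBody_spec`, `main_spec`).

For the running time only loop iterations are counted and only products are bounded. The other
operations lengthen numbers by a constant number of bits per instruction, so these two bounds
already give a polynomial logarithmic cost (`Run.exists_exec`). -/

namespace ArrayRAM

/-! ### Executions counted in loop iterations -/

theorem bitLength_le_of_natAbs_le {z : ℤ} {L : ℕ} (h : z.natAbs ≤ 2 ^ L) : bitLength z ≤ L + 2 := by
  have : Nat.size z.natAbs ≤ L + 1 :=
    Nat.size_le.2 (h.trans_lt (Nat.pow_lt_pow_right (by norm_num) (by omega)))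
  unfold bitLength
  omega

theorem natAbs_lt_two_pow_bitLength (z : ℤ) : z.natAbs < 2 ^ bitLength z :=
  (Nat.lt_size_self _).trans_le (Nat.pow_le_pow_right (by norm_num) (Nat.le_succ _))

/-- All products that occur in the evaluation of the expression are at most `2 ^ B` in absolute
value. -/
def Expr.Ok (B : ℕ) (σ : Memory) : Expr → Prop
  | .const _ => True
  | .read _ i => i.Ok B σ
  | .op o e₁ e₂ => e₁.Ok B σ ∧ e₂.Ok B σ ∧
      match o with
      | .mul => (e₁.eval σ * e₂.eval σ).natAbs ≤ 2 ^ B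
      | _ => True

/-- The number of nodes of an expression, plus the absolute values of its constants. -/
def Expr.weight : Expr → ℕ
  | .const z => z.natAbs + 1
  | .read _ i => i.weight + 1
  | .op _ e₁ e₂ => e₁.weight + e₂.weight + 1

/-- All cells are at most `2 ^ L` in absolute value. -/
def Memory.Bounded (L : ℕ) (σ : Memory) : Prop := ∀ a i, (σ a i).natAbs ≤ 2 ^ L

theorem Memory.Bounded.mono {L L' : ℕ} {σ : Memory} (h : σ.Bounded L) (hL : L ≤ L') :
    σ.Bounded L' := fun a i => (h a i).trans (Nat.pow_le_pow_right (by norm_num) hL)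

/-- Products are bounded by `Ok`; every other operation yields at most the sum of the absolute
values of its arguments, so the bounds add up like the weights. -/
theorem Expr.natAbs_eval_le {B L : ℕ} {σ : Memory} (hσ : σ.Bounded L) (hB : B ≤ L) :
    ∀ e : Expr, e.Ok B σ → (e.eval σ).natAbs ≤ e.weight * 2 ^ L
  | .const z, _ => by
      simp only [Expr.eval, Expr.weight]
      exact (Nat.le_succ _).trans (Nat.le_mul_of_pos_right _ (by positivity))
  | .read a i, _ => by
      simp only [Expr.eval, Expr.weight]
      exact (hσ a (i.eval σ)).trans (Nat.le_mul_of_pos_left _ (Nat.succ_pos _))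
  | .op o e₁ e₂, h => by
      obtain ⟨h₁, h₂, h₃⟩ := h
      have hBL : 2 ^ B ≤ 2 ^ L := Nat.pow_le_pow_right (by norm_num) hB
      have i₁ := Expr.natAbs_eval_le hσ hB e₁ h₁
      have i₂ := Expr.natAbs_eval_le hσ hB e₂ h₂
      have : 0 < 2 ^ L := by positivity
      simp only [Expr.eval, Expr.weight, add_mul, one_mul]
      generalize 2 ^ L = P at *
      cases o with
      | add => have := Int.natAbs_add_le (e₁.eval σ) (e₂.eval σ); simp only [Op.apply]; omega
      | sub => have := Int.natAbs_sub_le (e₁.eval σ) (e₂.eval σ); simp only [Op.apply]; omega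
      | mul =>
        simp only [Op.apply] at h₃ ⊢
        omega
      | div => have := Int.natAbs_ediv_le_natAbs (e₁.eval σ) (e₂.eval σ); simp only [Op.apply]; omega

/-- Each charged number is the value of a subexpression, hence has at most `L + g + 2` bits, and the
weight bounds how many there are. -/
theorem Expr.cost_le {B L g : ℕ} {σ : Memory} (hσ : σ.Bounded L) (hB : B ≤ L) :
    ∀ e : Expr, e.Ok B σ → e.weight ≤ 2 ^ g → e.cost σ ≤ e.weight * (L + g + 2)
  | .const z, h, hg => by
      have h₁ := Expr.natAbs_eval_le hσ hB (.const z) h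
      have := bitLength_le_of_natAbs_le (L := L + g) (z := z) <| h₁.trans <| by
        rw [pow_add, mul_comm]; exact Nat.mul_le_mul_left _ hg
      simp only [Expr.cost, Expr.weight]
      exact this.trans (Nat.le_mul_of_pos_left _ (Nat.succ_pos _))
  | .read a i, h, hg => by
      have h₁ := Expr.cost_le (g := g) hσ hB i h ((Nat.le_succ _).trans hg)
      have := bitLength_le_of_natAbs_le (hσ a (i.eval σ))
      simp only [Expr.cost, Expr.weight, add_mul]
      omega
  | .op o e₁ e₂, h, hg => by
      have h₀ := Expr.natAbs_eval_le hσ hB _ h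
      have := bitLength_le_of_natAbs_le (L := L + g) <| h₀.trans <| by
        rw [pow_add, mul_comm]; exact Nat.mul_le_mul_left _ hg
      have h₁ := Expr.cost_le (g := g) hσ hB e₁ h.1 (by simp only [Expr.weight] at hg; omega)
      have h₂ := Expr.cost_le (g := g) hσ hB e₂ h.2.1 (by simp only [Expr.weight] at hg; omega)
      simp only [Expr.cost, Expr.weight, add_mul, Expr.eval] at this ⊢
      omega

/-- `Run B c σ k σ'`: the program `c`, started in `σ`, halts in `σ'` after a total of `k` loop
iterations, and all products computed on the way are at most `2 ^ B`. -/
inductive Run (B : ℕ) : Program → Memory → ℕ → Memory → Prop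
  | skip (σ : Memory) : Run B .skip σ 0 σ
  | write (σ : Memory) (a : ℕ) (i e : Expr) : i.Ok B σ → e.Ok B σ →
      Run B (.write a i e) σ 0 (σ.store a (i.eval σ) (e.eval σ))
  | seq {σ σ' σ'' : Memory} {c₁ c₂ : Program} {k₁ k₂ : ℕ} :
      Run B c₁ σ k₁ σ' → Run B c₂ σ' k₂ σ'' → Run B (.seq c₁ c₂) σ (k₁ + k₂) σ''
  | ite_pos {σ σ' : Memory} {e : Expr} {c₁ c₂ : Program} {k : ℕ} : e.Ok B σ →
      0 < e.eval σ → Run B c₁ σ k σ' → Run B (.ite e c₁ c₂) σ k σ'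
  | ite_neg {σ σ' : Memory} {e : Expr} {c₁ c₂ : Program} {k : ℕ} : e.Ok B σ →
      e.eval σ ≤ 0 → Run B c₂ σ k σ' → Run B (.ite e c₁ c₂) σ k σ'
  | loop_step {σ σ' σ'' : Memory} {e : Expr} {c : Program} {k₁ k₂ : ℕ} : e.Ok B σ →
      0 < e.eval σ → Run B c σ k₁ σ' → Run B (.loop e c) σ' k₂ σ'' →
      Run B (.loop e c) σ (k₁ + k₂ + 1) σ''
  | loop_done {σ : Memory} {e : Expr} {c : Program} : e.Ok B σ →
      e.eval σ ≤ 0 → Run B (.loop e c) σ 0 σ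

/-- The number of instructions of a program. -/
def Program.size : Program → ℕ
  | .skip => 1
  | .write _ _ _ => 1
  | .seq c₁ c₂ => c₁.size + c₂.size
  | .ite _ c₁ c₂ => c₁.size + c₂.size + 1
  | .loop _ c => c.size + 1

/-- The total weight of the expressions of a program. -/
def Program.weight : Program → ℕ
  | .skip => 0
  | .write _ i e => i.weight + e.weight
  | .seq c₁ c₂ => c₁.weight + c₂.weight
  | .ite e c₁ c₂ => e.weight + c₁.weight + c₂.weight
  | .loop e c => e.weight + c.weight

theorem Memory.Bounded.store {L L' : ℕ} {σ : Memory} (h : σ.Bounded L) (hL : L ≤ L') (a : ℕ) (i : ℤ)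
    {v : ℤ} (hv : v.natAbs ≤ 2 ^ L') : (σ.store a i v).Bounded L' := by
  intro b j
  unfold Memory.store
  by_cases hb : b = a
  · subst hb
    by_cases hj : j = i
    · subst hj; simpa using hv
    · simpa [hj] using h.mono hL b j
  · simpa [hb] using h.mono hL b j

/-- A bound for the cost of one instruction. -/
def stepBound (g L : ℕ) : ℕ := 2 ^ g * (L + g + 2) + 1

theorem stepBound_mono (g : ℕ) {L L' : ℕ} (h : L ≤ L') : stepBound g L ≤ stepBound g L' := by
  unfold stepBound; gcongr

/-- Here `m` counts executed instructions. Each of them raises the exponent of the memory bound by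
at most `g`, because a stored value is at most weight times `2 ^ L`. So the numbers stay below `2 ^
(L + g * m)` during the whole run, and every instruction is charged at that final length. -/
theorem Run.exists_exec {B g : ℕ} {c : Program} {σ σ' : Memory} {k : ℕ} (h : Run B c σ k σ') :
    ∀ {L : ℕ}, c.weight ≤ 2 ^ g → σ.Bounded L → B ≤ L →
      ∃ m t, m ≤ (k + 1) * c.size ∧ Exec c σ t σ' ∧ t ≤ m * stepBound g (L + g * m) ∧
        σ'.Bounded (L + g * m) := by
  have test : ∀ {e : Expr} {σ : Memory} {L : ℕ}, e.Ok B σ → e.weight ≤ 2 ^ g → σ.Bounded L → B ≤ L →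
      1 + e.cost σ ≤ stepBound g L := by
    intro e σ L h hg hσ hB
    have := e.cost_le hσ hB h hg
    have := Nat.mul_le_mul_right (L + g + 2) hg
    unfold stepBound
    omega
  induction h with
  | skip σ =>
    intro L _ hσ _
    refine ⟨1, 1, by simp [Program.size], .skip σ, ?_, hσ.mono (by omega)⟩
    unfold stepBound; omega
  | write σ a i e hi he =>
    intro L hg hσ hB
    simp only [Program.weight] at hg
    refine ⟨1, _, by simp [Program.size], .write σ a i e, ?_, ?_⟩
    · have h₁ := i.cost_le (g := g) hσ hB hi (by omega)
      have h₂ := e.cost_le (g := g) hσ hB he (by omega)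
      have h₃ := Nat.mul_le_mul_right (L + g + 2) hg
      have := stepBound_mono g (L := L) (L' := L + g * 1) (by omega)
      rw [one_mul]
      refine le_trans ?_ this
      unfold stepBound
      rw [add_mul] at h₃
      omega
    · refine hσ.store (by omega) _ _ ((e.natAbs_eval_le hσ hB he).trans ?_)
      rw [mul_one, pow_add, mul_comm]
      exact Nat.mul_le_mul_left _ (by omega)
  | seq h₁ h₂ ih₁ ih₂ =>
    intro L hg hσ hB
    simp only [Program.weight] at hg
    obtain ⟨m₁, t₁, hm₁, e₁, ht₁, b₁⟩ := ih₁ (by omega) hσ hB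
    obtain ⟨m₂, t₂, hm₂, e₂, ht₂, b₂⟩ := ih₂ (by omega) b₁ (by omega)
    refine ⟨m₁ + m₂, _, ?_, .seq e₁ e₂, ?_, b₂.mono (by rw [mul_add]; omega)⟩
    · simp only [Program.size]; nlinarith
    · have hl : L + g * m₁ + g * m₂ = L + g * (m₁ + m₂) := by ring
      rw [hl] at ht₂
      have := Nat.mul_le_mul_left m₁ (stepBound_mono g (L := L + g * m₁) (L' := L + g * (m₁ + m₂))
        (by rw [mul_add]; omega))
      rw [add_mul]
      omega
  | @ite_pos σ σ' e c₁ c₂ k ho hp h ih =>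
    intro L hg hσ hB
    simp only [Program.weight] at hg
    obtain ⟨m, t, hm, ex, ht, b⟩ := ih (by omega) hσ hB
    refine ⟨m + 1, _, ?_, .ite_pos hp ex, ?_, b.mono (by rw [mul_add]; omega)⟩
    · simp only [Program.size]; nlinarith
    · have h₁ := (test ho (by omega) hσ hB).trans
        (stepBound_mono g (L' := L + g * (m + 1)) (by omega))
      have := Nat.mul_le_mul_left m (stepBound_mono g (L := L + g * m) (L' := L + g * (m + 1))
        (by rw [mul_add]; omega))
      rw [add_mul]
      omega
  | @ite_neg σ σ' e c₁ c₂ k ho hp h ih =>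
    intro L hg hσ hB
    simp only [Program.weight] at hg
    obtain ⟨m, t, hm, ex, ht, b⟩ := ih (by omega) hσ hB
    refine ⟨m + 1, _, ?_, .ite_neg hp ex, ?_, b.mono (by rw [mul_add]; omega)⟩
    · simp only [Program.size]; nlinarith
    · have h₁ := (test ho (by omega) hσ hB).trans
        (stepBound_mono g (L' := L + g * (m + 1)) (by omega))
      have := Nat.mul_le_mul_left m (stepBound_mono g (L := L + g * m) (L' := L + g * (m + 1))
        (by rw [mul_add]; omega))
      rw [add_mul]
      omega
  | @loop_step σ σ' σ'' e c k₁ k₂ ho hp h₁ h₂ ih₁ ih₂ =>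
    intro L hg hσ hB
    have hg' := hg
    simp only [Program.weight] at hg
    obtain ⟨m₁, t₁, hm₁, e₁, ht₁, b₁⟩ := ih₁ (by omega) hσ hB
    obtain ⟨m₂, t₂, hm₂, e₂, ht₂, b₂⟩ := ih₂ hg' b₁ (by omega)
    have hl : L + g * m₁ + g * m₂ = L + g * (m₁ + m₂) := by ring
    rw [hl] at ht₂ b₂
    refine ⟨m₁ + m₂ + 1, _, ?_, .loop_step hp e₁ e₂, ?_, b₂.mono (by rw [mul_add _ _ 1]; omega)⟩
    · simp only [Program.size] at hm₂ ⊢; nlinarith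
    · have h₀ := (test ho (by omega) hσ hB).trans
        (stepBound_mono g (L' := L + g * (m₁ + m₂ + 1)) (by omega))
      have h₁ := Nat.mul_le_mul_left m₁ (stepBound_mono g (L := L + g * m₁)
        (L' := L + g * (m₁ + m₂ + 1))
        (Nat.add_le_add_left (Nat.mul_le_mul_left g (by omega)) L))
      have h₂ := Nat.mul_le_mul_left m₂ (stepBound_mono g (L := L + g * (m₁ + m₂))
        (L' := L + g * (m₁ + m₂ + 1))
        (Nat.add_le_add_left (Nat.mul_le_mul_left g (by omega)) L))
      rw [add_mul, add_mul]
      omega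
  | @loop_done σ e c ho hp =>
    intro L hg hσ hB
    simp only [Program.weight] at hg
    refine ⟨1, _, by simp [Program.size], .loop_done hp, ?_, hσ.mono (by omega)⟩
    rw [one_mul]
    exact (test ho (by omega) hσ hB).trans (stepBound_mono g (by omega))

/-! ### Total-correctness rules with an iteration count -/

/-- Started in `σ`, the program halts after at most `k` loop iterations in a memory with the property
`Q`, and all products computed on the way are at most `2 ^ B`. -/
def Wp (B : ℕ) (c : Program) (k : ℕ) (Q : Memory → Prop) (σ : Memory) : Prop :=
  ∃ σ' k', k' ≤ k ∧ Run B c σ k' σ' ∧ Q σ'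

namespace Wp

variable {B k : ℕ} {Q : Memory → Prop} {σ : Memory}

theorem mono {c : Program} {k' : ℕ} {Q' : Memory → Prop} (h : Wp B c k Q σ) (hk : k ≤ k')
    (hQ : ∀ σ', Q σ' → Q' σ') : Wp B c k' Q' σ := by
  obtain ⟨σ', j, hj, hr, hq⟩ := h
  exact ⟨σ', j, hj.trans hk, hr, hQ _ hq⟩

theorem skip (h : Q σ) : Wp B .skip k Q σ := ⟨σ, 0, Nat.zero_le _, .skip σ, h⟩

theorem write {a : ℕ} {i e : Expr} (hi : i.Ok B σ) (he : e.Ok B σ)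
    (h : Q (σ.store a (i.eval σ) (e.eval σ))) : Wp B (.write a i e) k Q σ :=
  ⟨_, 0, Nat.zero_le _, .write σ a i e hi he, h⟩

theorem seq {c₁ c₂ : Program} {k₁ k₂ : ℕ} (h : Wp B c₁ k₁ (Wp B c₂ k₂ Q) σ) (hk : k₁ + k₂ ≤ k) :
    Wp B (.seq c₁ c₂) k Q σ := by
  obtain ⟨σ', j, hj, hr, σ'', j', hj', hr', hq⟩ := h
  exact ⟨σ'', _, by omega, hr.seq hr', hq⟩

theorem write_seq {a : ℕ} {i e : Expr} {c : Program} (hi : i.Ok B σ) (he : e.Ok B σ)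
    (h : Wp B c k Q (σ.store a (i.eval σ) (e.eval σ))) : Wp B (.seq (.write a i e) c) k Q σ :=
  seq (k₁ := 0) (k₂ := k) (write hi he h) (by omega)

theorem ite {e : Expr} {c₁ c₂ : Program} (he : e.Ok B σ) (h₁ : 0 < e.eval σ → Wp B c₁ k Q σ)
    (h₂ : e.eval σ ≤ 0 → Wp B c₂ k Q σ) : Wp B (.ite e c₁ c₂) k Q σ := by
  rcases lt_or_ge 0 (e.eval σ) with h | h
  · obtain ⟨σ', j, hj, hr, hq⟩ := h₁ h
    exact ⟨σ', j, hj, .ite_pos he h hr, hq⟩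
  · obtain ⟨σ', j, hj, hr, hq⟩ := h₂ h
    exact ⟨σ', j, hj, .ite_neg he h hr, hq⟩

/-- The rule for loops: the invariant `I m` guarantees that at most `m` iterations remain. -/
theorem loop {e : Expr} {c : Program} (I : ℕ → Memory → Prop) (b : ℕ)
    (hok : ∀ m σ, I m σ → e.Ok B σ)
    (hbody : ∀ m σ, I m σ → 0 < e.eval σ → Wp B c b (fun σ' => ∃ m' < m, I m' σ') σ)
    (hdone : ∀ m σ, I m σ → e.eval σ ≤ 0 → Q σ) (m : ℕ) (hI : I m σ) (hk : m * (b + 1) ≤ k) :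
    Wp B (.loop e c) k Q σ := by
  induction m using Nat.strong_induction_on generalizing σ k with
  | _ m ih =>
    rcases lt_or_ge 0 (e.eval σ) with h | h
    · obtain ⟨σ', j, hj, hr, m', hm', hI'⟩ := hbody m σ hI h
      obtain ⟨σ'', j', hj', hr', hq⟩ := ih m' hm' hI' le_rfl
      refine ⟨σ'', _, ?_, .loop_step (hok m σ hI) h hr hr', hq⟩
      -- An iteration costs at most `b + 1`: the loops inside the body, and the iteration itself.
      nlinarith
    · exact ⟨σ, 0, Nat.zero_le _, .loop_done (hok m σ hI) h, hdone m σ hI h⟩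

end Wp

theorem Memory.store_apply (σ : Memory) (a : ℕ) (i v : ℤ) (b : ℕ) (j : ℤ) :
    σ.store a i v b j = if b = a ∧ j = i then v else σ b j := by
  unfold Memory.store
  by_cases hb : b = a
  · subst hb
    by_cases hj : j = i <;> simp [hj]
  · simp [hb]

end ArrayRAM

/-! ### Cuts of a capacity matrix -/

/-- The total capacity of the arcs that leave the vertex set `S`; the vertices are the numbers below
`N`. -/
def cutValue (N : ℕ) (c : ℕ → ℕ → ℤ) (S : ℕ → Bool) : ℤ :=
  ∑ u ∈ Finset.range N, ∑ v ∈ Finset.range N, if S u = true ∧ S v = false then c u v else 0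

theorem cutValue_nonneg {N : ℕ} {c : ℕ → ℕ → ℤ} (hc : ∀ u < N, ∀ v < N, 0 ≤ c u v) (S : ℕ → Bool) :
    0 ≤ cutValue N c S := by
  refine Finset.sum_nonneg fun u hu => Finset.sum_nonneg fun v hv => ?_
  split_ifs
  · exact hc u (Finset.mem_range.1 hu) v (Finset.mem_range.1 hv)
  · exact le_rfl

theorem cutValue_le {N : ℕ} {c : ℕ → ℕ → ℤ} {S : ℕ → Bool} {M : ℤ} (hM : 0 ≤ M)
    (hc : ∀ u < N, ∀ v < N, S u = true → S v = false → c u v ≤ M) :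
    cutValue N c S ≤ (N * N : ℕ) * M := by
  have h : cutValue N c S ≤ ∑ u ∈ Finset.range N, ∑ v ∈ Finset.range N, M := by
    refine Finset.sum_le_sum fun u hu => Finset.sum_le_sum fun v hv => ?_
    split_ifs with h
    · exact hc u (Finset.mem_range.1 hu) v (Finset.mem_range.1 hv) h.1 h.2
    · exact hM
  simpa [mul_assoc] using h

/-- The program changes the network one arc at a time, so every update of a cut value is an instance
of this; `w` may be negative. -/
theorem cutValue_add_single {N : ℕ} {c c' : ℕ → ℕ → ℤ} {u v : ℕ} {w : ℤ} (hu : u < N) (hv : v < N)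
    (h : ∀ a < N, ∀ b < N, c' a b = c a b + if a = u ∧ b = v then w else 0) (S : ℕ → Bool) :
    cutValue N c' S = cutValue N c S + if S u = true ∧ S v = false then w else 0 := by
  have h₁ : cutValue N c' S = cutValue N c S + ∑ a ∈ Finset.range N, ∑ b ∈ Finset.range N,
      if a = u then if b = v then if S u = true ∧ S v = false then w else 0 else 0 else 0 := by
    unfold cutValue
    simp only [← Finset.sum_add_distrib]
    refine Finset.sum_congr rfl fun a ha => Finset.sum_congr rfl fun b hb => ?_
    rw [h a (Finset.mem_range.1 ha) b (Finset.mem_range.1 hb)]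
    by_cases hau : a = u <;> by_cases hbv : b = v <;> simp [hau, hbv]
    split_ifs <;> simp
  rw [h₁, Finset.sum_eq_single u (by intro a _ ha; simp [ha]) (by simp [hu]),
    Finset.sum_eq_single v (by intro a _ ha; simp [ha]) (by simp [hv])]
  simp

theorem mul_add_inj {N u v u' v' : ℕ} (hv : v < N) (hv' : v' < N) :
    (u : ℤ) * N + v = u' * N + v' ↔ u = u' ∧ v = v' := by
  constructor
  · intro h
    have h : N * u + v = N * u' + v' := by have := h; push_cast [mul_comm] at this ⊢; zify; linarith
    have h₁ := congrArg (· / N) h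
    have h₂ := congrArg (· % N) h
    have hN : 0 < N := by omega
    simp only [Nat.mul_add_div hN, Nat.mul_add_mod, Nat.mod_eq_of_lt hv, Nat.mod_eq_of_lt hv',
      Nat.div_eq_of_lt hv, Nat.div_eq_of_lt hv'] at h₁ h₂
    exact ⟨by omega, h₂⟩
  · rintro ⟨rfl, rfl⟩; rfl

namespace ArrayRAM

/-! ### The program -/

namespace Expr

instance : Add Expr := ⟨Expr.op .add⟩
instance : Sub Expr := ⟨Expr.op .sub⟩
instance : Mul Expr := ⟨Expr.op .mul⟩
instance : Div Expr := ⟨Expr.op .div⟩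

variable (σ : Memory) (B : ℕ) (e₁ e₂ : Expr)

theorem eval_const (z : ℤ) : (const z).eval σ = z := rfl
theorem eval_read (a : ℕ) : (read a e₁).eval σ = σ a (e₁.eval σ) := rfl
theorem eval_add : (e₁ + e₂).eval σ = e₁.eval σ + e₂.eval σ := rfl
theorem eval_sub : (e₁ - e₂).eval σ = e₁.eval σ - e₂.eval σ := rfl
theorem eval_mul : (e₁ * e₂).eval σ = e₁.eval σ * e₂.eval σ := rfl
theorem eval_div : (e₁ / e₂).eval σ = e₁.eval σ / e₂.eval σ := rfl

theorem ok_const (z : ℤ) : (const z).Ok B σ ↔ True := Iff.rfl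
theorem ok_read (a : ℕ) : (read a e₁).Ok B σ ↔ e₁.Ok B σ := Iff.rfl
theorem ok_add : (e₁ + e₂).Ok B σ ↔ e₁.Ok B σ ∧ e₂.Ok B σ := by
  show e₁.Ok B σ ∧ e₂.Ok B σ ∧ True ↔ _
  rw [and_true]
theorem ok_sub : (e₁ - e₂).Ok B σ ↔ e₁.Ok B σ ∧ e₂.Ok B σ := by
  show e₁.Ok B σ ∧ e₂.Ok B σ ∧ True ↔ _
  rw [and_true]
theorem ok_div : (e₁ / e₂).Ok B σ ↔ e₁.Ok B σ ∧ e₂.Ok B σ := by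
  show e₁.Ok B σ ∧ e₂.Ok B σ ∧ True ↔ _
  rw [and_true]
theorem ok_mul : (e₁ * e₂).Ok B σ ↔
    e₁.Ok B σ ∧ e₂.Ok B σ ∧ (e₁.eval σ * e₂.eval σ).natAbs ≤ 2 ^ B := Iff.rfl

/-- A scalar variable: the cell with index `0` of an array. -/
def var (a : ℕ) : Expr := .read a (.const 0)

theorem eval_var (a : ℕ) : (var a).eval σ = σ a 0 := rfl
theorem ok_var (a : ℕ) : (var a).Ok B σ ↔ True := Iff.rfl

end Expr

namespace MinCut

open ArrayRAM.Expr

/-! The arrays of the program: `2` is the residual capacity matrix (row by row), `3` the time stamps of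
the reverse search (a vertex is marked if its stamp is at least the stamp of the sink), `4` the next
vertex on the way to the sink.  The variables: `5` the number of vertices, `6` the common denominator,
`7` a counter, `8` the scale, `9` the clock, `10` the time when the search began, `11` the current vertex
of the path, `12` the number of players, `13` to `16` temporary values.  If `n` is the number of players,
then the source is `n` and the sink is `n + 1`. -/

/-- Moves one scale unit of capacity along the next arc of the path. -/
def walkBody : Program :=
  .seq (.write 14 (.const 0) (.read 4 (var 11))) <|
  .seq (.write 2 (var 11 * var 5 + var 14) (.read 2 (var 11 * var 5 + var 14) - var 8)) <|
  .seq (.write 2 (var 14 * var 5 + var 11) (.read 2 (var 14 * var 5 + var 11) + var 8)) <|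
  .write 11 (.const 0) (var 14)

/-- Augments along the path from the source to the sink. -/
def walk : Program :=
  .seq (.write 11 (.const 0) (var 12)) (.loop (var 12 + .const 1 - var 11) walkBody)

/-- Inspects one arc; if it extends the search tree, the scan starts anew. -/
def scanBody : Program :=
  .seq (.write 13 (.const 0) (var 7 / var 5)) <|
  .seq (.write 14 (.const 0) (var 7 - var 13 * var 5)) <|
  .seq (.write 7 (.const 0) (var 7 + .const 1)) <|
  .ite (.read 3 (var 14) - var 10 + .const 1)
    (.ite (var 10 - .read 3 (var 13))
      (.ite (.read 2 (var 13 * var 5 + var 14) - var 8 + .const 1)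
        (.seq (.write 9 (.const 0) (var 9 + .const 1)) <|
          .seq (.write 3 (var 13) (var 9)) <|
          .seq (.write 4 (var 13) (var 14)) <|
          .write 7 (.const 0) (.const 0))
        .skip)
      .skip)
    .skip

/-- Marks all vertices from which the sink can be reached through arcs whose capacity is at least the
scale. -/
def scan : Program :=
  .seq (.write 9 (.const 0) (var 9 + .const 1)) <|
  .seq (.write 10 (.const 0) (var 9)) <|
  .seq (.write 3 (var 12 + .const 1) (var 9)) <|
  .seq (.write 7 (.const 0) (.const 0)) <|
  .loop (var 5 * var 5 - var 7) scanBody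

/-- Augments, or halves the scale if this is impossible. -/
def phaseBody : Program :=
  .seq scan <|
  .ite (.read 3 (var 12) - var 10 + .const 1) walk (.write 8 (.const 0) (var 8 / .const 2))

/-- The residual capacity of the arc from `u` to `v`. -/
def cap (N : ℕ) (σ : Memory) (u v : ℕ) : ℤ := σ 2 ((u : ℤ) * N + v)

theorem cap_store {N : ℕ} {σ : Memory} {u v a b : ℕ} (hv : v < N) (hb : b < N) (w : ℤ) :
    cap N (σ.store 2 ((u : ℤ) * N + v) w) a b = if a = u ∧ b = v then w else cap N σ a b := by
  unfold cap
  rw [Memory.store_apply]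
  simp only [true_and, mul_add_inj hb hv]

theorem cap_congr {N : ℕ} {σ σ' : Memory} (h : σ' 2 = σ 2) : cap N σ' = cap N σ := by
  funext u v
  simp only [cap, h]

/-! ### Augmentation along a marked path -/

/-- The vertex `u` is the sink, or its successor is a vertex marked earlier, and the arc to the
successor has at least the capacity of the scale. -/
def Linked (n : ℕ) (σ : Memory) (u : ℕ) : Prop :=
  u = n + 1 ∨ ∃ v < n + 2, σ 4 u = v ∧ σ 10 0 ≤ σ 3 v ∧ σ 3 v < σ 3 u ∧ σ 8 0 ≤ cap (n + 2) σ u v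

/-- The invariant of the augmentation, where `σ₀` is the memory at its beginning. -/
structure WalkInv (n : ℕ) (σ₀ : Memory) (m : ℕ) (σ : Memory) : Prop where
  stamp : σ 3 = σ₀ 3
  next : σ 4 = σ₀ 4
  order : σ 5 = σ₀ 5
  scale : σ 8 = σ₀ 8
  clock : σ 9 = σ₀ 9
  base : σ 10 = σ₀ 10
  players : σ 12 = σ₀ 12
  cap_nonneg : ∀ u < n + 2, ∀ v < n + 2, 0 ≤ cap (n + 2) σ u v
  token : ∃ x < n + 2, σ 11 0 = (x : ℕ) ∧ σ₀ 10 0 ≤ σ₀ 3 x ∧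
    (∀ u < n + 2, σ₀ 10 0 ≤ σ₀ 3 u → σ₀ 3 u ≤ σ₀ 3 x → Linked n σ u) ∧
    (∀ S : ℕ → Bool, cutValue (n + 2) (cap (n + 2) σ) S + (if S x = true then 0 else σ₀ 8 0) =
      cutValue (n + 2) (cap (n + 2) σ₀) S + (if S n = true then 0 else σ₀ 8 0)) ∧
    m = ((Finset.range (n + 2)).filter fun u : ℕ => σ₀ 10 0 ≤ σ₀ 3 u ∧ σ₀ 3 u < σ₀ 3 x).card

/-- A token carries one scale unit from the source to the sink. The cut value of `S`, plus one unit
if the token is outside `S`, does not change: moving from `x` to `v` takes a unit from the arc `xv`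
and gives it to `vx`. Once the token is at the sink, every cut separating source and sink has lost
exactly one unit. Stamps strictly decrease along the path, so it cannot return to a vertex. -/
theorem walk_spec {B n k : ℕ} {σ₀ : Memory} (hB : (n + 2) * (n + 2) ≤ 2 ^ B)
    (hN : σ₀ 5 0 = (n + 2 : ℕ)) (hn : σ₀ 12 0 = n) (hΔ : 0 ≤ σ₀ 8 0)
    (hc : ∀ u < n + 2, ∀ v < n + 2, 0 ≤ cap (n + 2) σ₀ u v)
    (hl : ∀ u < n + 2, σ₀ 10 0 ≤ σ₀ 3 u → Linked n σ₀ u) (hs : σ₀ 10 0 ≤ σ₀ 3 n) (hk : n + 2 ≤ k) :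
    Wp B walk k (fun σ => σ 3 = σ₀ 3 ∧ σ 5 = σ₀ 5 ∧ σ 8 = σ₀ 8 ∧ σ 9 = σ₀ 9 ∧ σ 10 = σ₀ 10 ∧
      σ 12 = σ₀ 12 ∧ (∀ u < n + 2, ∀ v < n + 2, 0 ≤ cap (n + 2) σ u v) ∧
      ∀ S : ℕ → Bool, S n = true → S (n + 1) = false →
        cutValue (n + 2) (cap (n + 2) σ) S + σ₀ 8 0 = cutValue (n + 2) (cap (n + 2) σ₀) S) σ₀ := by
  have hmul : ∀ u < n + 2, ((u : ℤ) * ((n + 2 : ℕ) : ℤ)).natAbs ≤ 2 ^ B := fun u hu => by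
    rw [← Nat.cast_mul, Int.natAbs_natCast]
    exact (Nat.mul_le_mul_right _ hu.le).trans hB
  refine Wp.write_seq (by simp [ok_const]) (by simp [ok_var]) ?_
  refine Wp.loop (WalkInv n σ₀) 0 ?_ ?_ ?_
    ((Finset.range (n + 2)).filter fun u : ℕ => σ₀ 10 0 ≤ σ₀ 3 u ∧ σ₀ 3 u < σ₀ 3 n).card ?_ ?_
  · intro m σ h
    simp [ok_sub, ok_add, ok_var, ok_const]
  · rintro m σ ⟨h3, h4, h5, h8, h9, h10, h12, hcap, x, hx, hσx, hbx, hlink, hcut, hm⟩ hpos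
    rw [eval_sub, eval_add, eval_var, eval_var, eval_const, h12, hn, hσx] at hpos
    rcases hlink x hx hbx le_rfl with rfl | ⟨v, hv, hnv, hbv, hvx, hΔv⟩
    -- The loop test fails at the sink `n + 1`, so the token is at a vertex with a successor.
    · push_cast at hpos; omega
    have hNσ : σ 5 0 = (n + 2 : ℕ) := by rw [h5, hN]
    have hne : x ≠ v := by rintro rfl; omega
    unfold walkBody
    refine Wp.write_seq (by simp [ok_const]) (by simp [ok_var, ok_read]) ?_
    simp only [eval_const, eval_read, eval_var, hσx, hnv]
    refine Wp.write_seq ?_ ?_ ?_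
    · simp only [ok_add, ok_mul, ok_var, eval_var, Memory.store_apply, hσx, hNσ]
      simpa using hmul x hx
    · simp only [ok_sub, ok_read, ok_add, ok_mul, ok_var, eval_var, Memory.store_apply, hσx, hNσ]
      simpa using hmul x hx
    simp only [eval_add, eval_sub, eval_mul, eval_read, eval_var]
    set σ₁ := σ.store 14 0 v with hσ₁
    have e₁ : σ₁ 11 0 = x := by simp [hσ₁, Memory.store_apply, hσx]
    have e₂ : σ₁ 5 0 = (n + 2 : ℕ) := by simp [hσ₁, Memory.store_apply, hNσ]
    have e₃ : σ₁ 14 0 = v := by simp [hσ₁, Memory.store_apply]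
    have e₄ : σ₁ 8 0 = σ 8 0 := by simp [hσ₁, Memory.store_apply]
    rw [e₁, e₂, e₃, e₄]
    set σ₂ := σ₁.store 2 ((x : ℤ) * (n + 2 : ℕ) + v) (σ₁ 2 ((x : ℤ) * (n + 2 : ℕ) + v) - σ 8 0) with hσ₂
    have f₁ : σ₂ 11 0 = x := by simp [hσ₂, Memory.store_apply, e₁]
    have f₂ : σ₂ 5 0 = (n + 2 : ℕ) := by simp [hσ₂, Memory.store_apply, e₂]
    have f₃ : σ₂ 14 0 = v := by simp [hσ₂, Memory.store_apply, e₃]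
    have f₄ : σ₂ 8 0 = σ 8 0 := by simp [hσ₂, Memory.store_apply, e₄]
    refine Wp.write_seq ?_ ?_ ?_
    · simp only [ok_add, ok_mul, ok_var, eval_var, f₂, f₃]
      simpa using hmul v hv
    · simp only [ok_read, ok_add, ok_mul, ok_var, eval_var, f₂, f₃]
      simpa using hmul v hv
    simp only [eval_add, eval_mul, eval_read, eval_var, f₁, f₂, f₃, f₄]
    set σ₃ := σ₂.store 2 ((v : ℤ) * (n + 2 : ℕ) + x) (σ₂ 2 ((v : ℤ) * (n + 2 : ℕ) + x) + σ 8 0) with hσ₃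
    refine Wp.write (by simp [ok_const]) (by simp [ok_var]) ?_
    have g₁ : σ₃ 14 0 = v := by simp [hσ₃, Memory.store_apply, f₃]
    simp only [eval_const, eval_var, g₁]
    set σ₄ := σ₃.store 11 0 v with hσ₄
    have harr : ∀ a, a ≠ 2 → a ≠ 11 → a ≠ 14 → σ₄ a = σ a := by
      intro a h₁ h₂ h₃
      funext i
      simp [hσ₄, hσ₃, hσ₂, hσ₁, Memory.store_apply, h₁, h₂, h₃]
    have hc₁ : cap (n + 2) σ₁ = cap (n + 2) σ :=
      cap_congr (by funext i; simp [hσ₁, Memory.store_apply])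
    have hc₂ : ∀ a < n + 2, ∀ b < n + 2, cap (n + 2) σ₂ a b =
        cap (n + 2) σ a b + if a = x ∧ b = v then - σ 8 0 else 0 := by
      intro a ha b hb
      rw [hσ₂, cap_store hv hb]
      split_ifs with h
      · rw [h.1, h.2, ← hc₁]; simp only [cap]; ring
      · rw [hc₁, add_zero]
    have hc₃ : ∀ a < n + 2, ∀ b < n + 2, cap (n + 2) σ₃ a b =
        cap (n + 2) σ₂ a b + if a = v ∧ b = x then σ 8 0 else 0 := by
      intro a ha b hb
      rw [hσ₃, cap_store hx hb]
      split_ifs with h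
      · rw [h.1, h.2]; simp only [cap]
      · rw [add_zero]
    have hc₄ : cap (n + 2) σ₄ = cap (n + 2) σ₃ :=
      cap_congr (by funext i; simp [hσ₄, Memory.store_apply])
    have hΔσ : 0 ≤ σ 8 0 := by rw [h8]; exact hΔ
    refine ⟨_, ?_, ⟨?_, ?_, ?_, ?_, ?_, ?_, ?_, ?_, v, hv, ?_, ?_, ?_, ?_, rfl⟩⟩
    · rw [hm]
      apply Finset.card_lt_card
      rw [h10] at hbv
      rw [h3] at hbv hvx
      constructor
      · intro u
        simp only [Finset.mem_filter]
        exact fun h => ⟨h.1, h.2.1, h.2.2.trans hvx⟩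
      · intro h
        have := h (Finset.mem_filter.2 ⟨Finset.mem_range.2 hv, hbv, hvx⟩)
        exact lt_irrefl _ (Finset.mem_filter.1 this).2.2
    · rw [harr 3 (by decide) (by decide) (by decide), h3]
    · rw [harr 4 (by decide) (by decide) (by decide), h4]
    · rw [harr 5 (by decide) (by decide) (by decide), h5]
    · rw [harr 8 (by decide) (by decide) (by decide), h8]
    · rw [harr 9 (by decide) (by decide) (by decide), h9]
    · rw [harr 10 (by decide) (by decide) (by decide), h10]
    · rw [harr 12 (by decide) (by decide) (by decide), h12]
    · intro a ha b hb
      rw [hc₄, hc₃ a ha b hb, hc₂ a ha b hb]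
      have := hcap a ha b hb
      by_cases h₁ : a = x ∧ b = v
      · obtain ⟨rfl, rfl⟩ := h₁
        simp [hne]; omega
      · split_ifs <;> omega
    · simp [hσ₄, Memory.store_apply]
    · rw [← h3, ← h10]; exact hbv
    · intro u hu hbu huv
      rw [h3] at hvx
      rcases hlink u hu hbu (huv.trans hvx.le) with h | ⟨w, hw, h₁, h₂, h₃, h₄⟩
      · exact .inl h
      · refine .inr ⟨w, hw, ?_, ?_, ?_, ?_⟩
        · rw [harr 4 (by decide) (by decide) (by decide), h₁]
        · rw [harr 10 (by decide) (by decide) (by decide), harr 3 (by decide) (by decide) (by decide)]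
          exact h₂
        · rw [harr 3 (by decide) (by decide) (by decide)]
          exact h₃
        · rw [harr 8 (by decide) (by decide) (by decide), hc₄, hc₃ u hu w hw, hc₂ u hu w hw]
          -- Only the arc `xv` loses capacity, and `x` has a later stamp than every vertex still
          -- ahead of the token.
          have h₅ : ¬ (u = x ∧ w = v) := by rintro ⟨rfl, -⟩; omega
          rw [if_neg h₅]
          split_ifs <;> omega
    · intro S
      rw [← hcut S, hc₄, cutValue_add_single hv hx hc₃, cutValue_add_single hx hv hc₂, ← h8]
      cases S x <;> cases S v <;> simp
  · rintro m σ ⟨h3, h4, h5, h8, h9, h10, h12, hcap, x, hx, hσx, hbx, hlink, hcut, hm⟩ hpos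
    rw [eval_sub, eval_add, eval_var, eval_var, eval_const, h12, hn, hσx] at hpos
    refine ⟨h3, h5, h8, h9, h10, h12, hcap, fun S hs ht => ?_⟩
    obtain rfl : x = n + 1 := by omega
    simpa [hs, ht] using hcut S
  · have harr : ∀ a, a ≠ 11 → σ₀.store 11 0 n a = σ₀ a := by
      intro a h
      funext i
      simp [Memory.store_apply, h]
    simp only [eval_const, eval_var, hn]
    have hcap : cap (n + 2) (σ₀.store 11 0 n) = cap (n + 2) σ₀ := cap_congr (harr 2 (by decide))
    refine ⟨harr _ (by decide), harr _ (by decide), harr _ (by decide), harr _ (by decide),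
      harr _ (by decide), harr _ (by decide), harr _ (by decide), by rwa [hcap], n, by omega,
      by simp [Memory.store_apply], hs, fun u hu h _ => ?_, fun S => by rw [hcap], rfl⟩
    unfold Linked
    rw [hcap, harr 4 (by decide), harr 10 (by decide), harr 3 (by decide), harr 8 (by decide)]
    exact hl u hu h
  · rw [zero_add, mul_one]
    refine (Finset.card_le_card (Finset.filter_subset _ _)).trans ?_
    rwa [Finset.card_range]

/-! ### Reverse search with time stamps -/

/-- The vertices that are not marked. -/
def unmarked (n : ℕ) (σ : Memory) : Finset ℕ :=
  (Finset.range (n + 2)).filter fun u : ℕ => σ 3 u < σ 10 0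

/-- The invariant of the reverse search, where `σ₀` is the memory at its beginning. -/
structure ScanInv (n : ℕ) (σ₀ : Memory) (m : ℕ) (σ : Memory) : Prop where
  matrix : σ 2 = σ₀ 2
  order : σ 5 = σ₀ 5
  scale : σ 8 = σ₀ 8
  base : σ 10 = σ₀ 10
  players : σ 12 = σ₀ 12
  base_le : σ 10 0 ≤ σ 9 0
  stamp_le : ∀ u < n + 2, σ 3 (u : ℕ) ≤ σ 9 0
  sink : σ 10 0 ≤ σ 3 (n + 1 : ℕ)
  link : ∀ u < n + 2, σ 10 0 ≤ σ 3 (u : ℕ) → Linked n σ u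
  counter : ∃ p ≤ (n + 2) * (n + 2), σ 7 0 = (p : ℕ) ∧
    (∀ u < n + 2, ∀ v < n + 2, u * (n + 2) + v < p → σ 3 u < σ 10 0 → σ 10 0 ≤ σ 3 v →
      cap (n + 2) σ u v < σ 8 0) ∧
    m = (unmarked n σ).card * ((n + 2) * (n + 2) + 1) + ((n + 2) * (n + 2) - p)

/-- The outcome of the reverse search. -/
structure Scanned (n : ℕ) (σ₀ : Memory) (σ : Memory) : Prop where
  matrix : σ 2 = σ₀ 2
  order : σ 5 = σ₀ 5
  scale : σ 8 = σ₀ 8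
  players : σ 12 = σ₀ 12
  stamp_le : ∀ u < n + 2, σ 3 (u : ℕ) ≤ σ 9 0
  sink : σ 10 0 ≤ σ 3 (n + 1 : ℕ)
  link : ∀ u < n + 2, σ 10 0 ≤ σ 3 (u : ℕ) → Linked n σ u
  closed : ∀ u < n + 2, ∀ v < n + 2, σ 3 u < σ 10 0 → σ 10 0 ≤ σ 3 v → cap (n + 2) σ u v < σ 8 0

/-- The measure is lexicographic: marking a vertex shrinks the unmarked set and pays for resetting
the counter, and otherwise the counter advances. A new stamp exceeds all old ones, so successors
always carry smaller stamps. -/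
theorem scanBody_spec {B n m : ℕ} {σ₀ σ : Memory} (hB : (n + 2) * (n + 2) ≤ 2 ^ B)
    (hN : σ₀ 5 0 = (n + 2 : ℕ)) (h : ScanInv n σ₀ m σ) (hp : σ 7 0 < ((n + 2) * (n + 2) : ℕ)) :
    Wp B scanBody 0 (fun σ' => ∃ m' < m, ScanInv n σ₀ m' σ') σ := by
  obtain ⟨h2, h5, h8, h10, h12, hT, hle, hsink, hlink, p, hpN, hσp, hclosed, hm⟩ := h
  rw [hσp, Nat.cast_lt] at hp
  have hNσ : σ 5 0 = (n + 2 : ℕ) := by rw [h5, hN]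
  obtain ⟨u, v, hu, hv, rfl⟩ : ∃ u v, u < n + 2 ∧ v < n + 2 ∧ p = u * (n + 2) + v :=
    ⟨p / (n + 2), p % (n + 2), Nat.div_lt_of_lt_mul hp, Nat.mod_lt _ (by omega),
      (Nat.div_add_mod' _ _).symm⟩
  have hmul : ((u : ℤ) * ((n + 2 : ℕ) : ℤ)).natAbs ≤ 2 ^ B := by
    rw [← Nat.cast_mul, Int.natAbs_natCast]
    exact (Nat.mul_le_mul_right _ hu.le).trans hB
  have hdiv : ((u * (n + 2) + v : ℕ) : ℤ) / (n + 2 : ℕ) = u := by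
    rw [← Int.natCast_div, Nat.add_comm, Nat.add_mul_div_right _ _ (by omega), Nat.div_eq_of_lt hv,
      zero_add]
  refine Wp.write_seq (by simp [ok_const]) (by simp [ok_var, ok_div]) ?_
  simp only [eval_const, eval_var, eval_div, hσp, hNσ, hdiv]
  set σ₁ := σ.store 13 0 u with hσ₁
  have a₁ : ∀ a, a ≠ 13 → σ₁ a = σ a := by
    intro a h; funext i; simp [hσ₁, Memory.store_apply, h]
  have a₂ : σ₁ 13 0 = u := by simp [hσ₁, Memory.store_apply]
  refine Wp.write_seq (by simp [ok_const]) ?_ ?_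
  · simpa [ok_var, ok_sub, ok_mul, eval_var, a₁, a₂, hNσ] using hmul
  simp only [eval_const, eval_var, eval_sub, eval_mul, a₁ 5 (by decide), a₁ 7 (by decide), a₂, hσp, hNσ]
  rw [show ((u * (n + 2) + v : ℕ) : ℤ) - u * (n + 2 : ℕ) = v by push_cast; ring]
  set σ₂ := σ₁.store 14 0 v with hσ₂
  refine Wp.write_seq (by simp [ok_const]) (by simp [ok_var, ok_const, ok_add]) ?_
  have b₁ : σ₂ 7 0 = (u * (n + 2) + v : ℕ) := by simp [hσ₂, hσ₁, Memory.store_apply, hσp]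
  simp only [eval_const, eval_var, eval_add, b₁]
  set σ₃ := σ₂.store 7 0 ((u * (n + 2) + v : ℕ) + 1) with hσ₃
  have harr : ∀ a, a ≠ 7 → a ≠ 13 → a ≠ 14 → σ₃ a = σ a := by
    intro a h₁ h₂ h₃
    funext i
    simp [hσ₃, hσ₂, hσ₁, Memory.store_apply, h₁, h₂, h₃]
  have c₁ : σ₃ 13 0 = u := by simp [hσ₃, hσ₂, hσ₁, Memory.store_apply]
  have c₂ : σ₃ 14 0 = v := by simp [hσ₃, hσ₂, Memory.store_apply]
  have c₃ : σ₃ 7 0 = (u * (n + 2) + v : ℕ) + 1 := by simp [hσ₃, Memory.store_apply]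
  have hcap : cap (n + 2) σ₃ = cap (n + 2) σ := cap_congr (harr 2 (by decide) (by decide) (by decide))
  have d3 := harr 3 (by decide) (by decide) (by decide)
  have d4 := harr 4 (by decide) (by decide) (by decide)
  have d5 := harr 5 (by decide) (by decide) (by decide)
  have d8 := harr 8 (by decide) (by decide) (by decide)
  have d9 := harr 9 (by decide) (by decide) (by decide)
  have d10 := harr 10 (by decide) (by decide) (by decide)
  have d12 := harr 12 (by decide) (by decide) (by decide)
  -- Common to the three tests: if one of them fails, only the counter has moved, and the arc just
  -- inspected joins the verified ones.
  have hskip : ¬ (σ 3 u < σ 10 0 ∧ σ 10 0 ≤ σ 3 v ∧ σ 8 0 ≤ cap (n + 2) σ u v) →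
      Wp B .skip 0 (fun σ' => ∃ m' < m, ScanInv n σ₀ m' σ') σ₃ := by
    intro hno
    refine Wp.skip ⟨_, ?_, ⟨?_, ?_, ?_, ?_, ?_, ?_, ?_, ?_, ?_, u * (n + 2) + v + 1, hp, ?_, ?_, rfl⟩⟩
    · rw [hm]
      have : unmarked n σ₃ = unmarked n σ := by unfold unmarked; rw [d3, d10]
      rw [this]
      omega
    · rw [harr 2 (by decide) (by decide) (by decide), h2]
    · rw [d5, h5]
    · rw [d8, h8]
    · rw [d10, h10]
    · rw [d12, h12]
    · rw [d10, d9]; exact hT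
    · rw [d3, d9]; exact hle
    · rw [d3, d10]; exact hsink
    · unfold Linked; rw [d3, d10, d8, d4, hcap]; exact hlink
    · rw [c₃]; push_cast; ring
    · intro a ha b hb hab
      rw [d3, d10, d8, hcap]
      rcases Nat.lt_succ_iff_lt_or_eq.1 hab with hab | hab
      · exact hclosed a ha b hb hab
      · intro h₁ h₂
        have := (mul_add_inj (u := a) (u' := u) hb hv).1 (by exact_mod_cast hab)
        rw [this.1] at h₁ ⊢
        rw [this.2] at h₂ ⊢
        by_contra h₃
        exact hno ⟨h₁, h₂, not_lt.1 h₃⟩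
  refine Wp.ite (by simp [ok_var, ok_read, ok_const, ok_add, ok_sub]) ?_ ?_
  swap
  · simp only [eval_add, eval_sub, eval_read, eval_var, eval_const, c₂, d3, d10]
    exact fun h => hskip (by omega)
  simp only [eval_add, eval_sub, eval_read, eval_var, eval_const, c₂, d3, d10]
  intro h₁
  refine Wp.ite (by simp [ok_var, ok_read, ok_sub]) ?_ ?_
  swap
  · simp only [eval_sub, eval_read, eval_var, c₁, d3, d10]
    exact fun h => hskip (by omega)
  simp only [eval_sub, eval_read, eval_var, c₁, d3, d10]
  intro h₂
  have hread : σ₃ 2 ((u : ℤ) * (n + 2 : ℕ) + v) = cap (n + 2) σ u v := by rw [← hcap]; rfl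
  refine Wp.ite ?_ ?_ ?_
  · simpa [ok_var, ok_read, ok_const, ok_add, ok_sub, ok_mul, eval_var, c₁, d5, hNσ] using hmul
  swap
  · simp only [eval_add, eval_mul, eval_sub, eval_read, eval_var, eval_const, c₁, c₂, d5, hNσ, d8,
      hread]
    exact fun h => hskip (by omega)
  simp only [eval_add, eval_mul, eval_sub, eval_read, eval_var, eval_const, c₁, c₂, d5, hNσ, d8,
      hread]
  intro h₃
  refine Wp.write_seq (by simp [ok_const]) (by simp [ok_var, ok_const, ok_add]) ?_
  simp only [eval_const, eval_var, eval_add, d9]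
  set σ₄ := σ₃.store 9 0 (σ 9 0 + 1) with hσ₄
  refine Wp.write_seq (by simp [ok_var]) (by simp [ok_var]) ?_
  have f₁ : σ₄ 13 0 = u := by simp [hσ₄, Memory.store_apply, c₁]
  have f₂ : σ₄ 9 0 = σ 9 0 + 1 := by simp [hσ₄, Memory.store_apply]
  simp only [eval_var, f₁, f₂]
  set σ₅ := σ₄.store 3 u (σ 9 0 + 1) with hσ₅
  refine Wp.write_seq (by simp [ok_var]) (by simp [ok_var]) ?_
  have g₁ : σ₅ 13 0 = u := by simp [hσ₅, Memory.store_apply, f₁]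
  have g₂ : σ₅ 14 0 = v := by simp [hσ₅, hσ₄, Memory.store_apply, c₂]
  simp only [eval_var, g₁, g₂]
  set σ₆ := σ₅.store 4 u v with hσ₆
  refine Wp.write (by simp [ok_const]) (by simp [ok_const]) ?_
  simp only [eval_const]
  set σ₇ := σ₆.store 7 0 0 with hσ₇
  have harr' : ∀ a, a ≠ 3 → a ≠ 4 → a ≠ 7 → a ≠ 9 → σ₇ a = σ₃ a := by
    intro a h₁ h₂ h₃ h₄
    funext i
    simp [hσ₇, hσ₆, hσ₅, hσ₄, Memory.store_apply, h₁, h₂, h₃, h₄]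
  have e2 := harr' 2 (by decide) (by decide) (by decide) (by decide)
  have e5 := harr' 5 (by decide) (by decide) (by decide) (by decide)
  have e8 := harr' 8 (by decide) (by decide) (by decide) (by decide)
  have e10 := harr' 10 (by decide) (by decide) (by decide) (by decide)
  have e12 := harr' 12 (by decide) (by decide) (by decide) (by decide)
  have e3 : ∀ a : ℕ, σ₇ 3 a = if a = u then σ 9 0 + 1 else σ 3 a := by
    intro a
    simp [hσ₇, hσ₆, hσ₅, hσ₄, Memory.store_apply, d3]
  have e4 : ∀ a : ℕ, σ₇ 4 a = if a = u then (v : ℤ) else σ 4 a := by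
    intro a
    simp [hσ₇, hσ₆, hσ₅, hσ₄, Memory.store_apply, d4]
  have e7 : σ₇ 7 0 = 0 := by simp [hσ₇, Memory.store_apply]
  have e9 : σ₇ 9 0 = σ 9 0 + 1 := by simp [hσ₇, hσ₆, hσ₅, hσ₄, Memory.store_apply]
  have hcap' : cap (n + 2) σ₇ = cap (n + 2) σ := by rw [← hcap]; exact cap_congr e2
  rw [d8] at e8
  rw [d10] at e10
  have hvu : v ≠ u := by rintro rfl; omega
  -- The counter restarts at `0`, since a newly marked vertex invalidates what was verified about
  -- arcs ending there.
  refine ⟨_, ?_, ⟨?_, ?_, ?_, ?_, ?_, ?_, ?_, ?_, ?_, 0, Nat.zero_le _, ?_, ?_, rfl⟩⟩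
  · have : (unmarked n σ₇).card < (unmarked n σ).card := by
      apply Finset.card_lt_card
      constructor
      · intro a
        simp only [unmarked, Finset.mem_filter, e3, e10]
        rintro ⟨h₁, h₂⟩
        split_ifs at h₂ with h
        · omega
        · exact ⟨h₁, h₂⟩
      · intro h
        have := h (Finset.mem_filter.2 ⟨Finset.mem_range.2 hu, by omega⟩)
        have := (Finset.mem_filter.1 this).2
        rw [e3, if_pos rfl, e10] at this
        omega
    rw [hm]
    have := Nat.mul_le_mul_right ((n + 2) * (n + 2) + 1) this
    rw [Nat.succ_mul] at this
    omega
  · rw [e2, harr 2 (by decide) (by decide) (by decide), h2]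
  · rw [e5, d5, h5]
  · rw [e8, h8]
  · rw [e10, h10]
  · rw [e12, d12, h12]
  · rw [e10, e9]; omega
  · intro a ha
    have := hle a ha
    rw [e3, e9]
    split_ifs <;> omega
  · rw [e3, e10]
    split_ifs <;> omega
  · intro a ha hba
    by_cases hau : a = u
    · refine .inr ⟨v, hv, ?_, ?_, ?_, ?_⟩
      · rw [e4, if_pos hau]
      · rw [e10, e3, if_neg hvu]; omega
      · have := hle v hv
        rw [e3, if_neg hvu, e3, if_pos hau]; omega
      · rw [e8, hcap', hau]; omega
    · rw [e3, if_neg hau, e10] at hba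
      rcases hlink a ha hba with h | ⟨w, hw, i₁, i₂, i₃, i₄⟩
      · exact .inl h
      · have hwu : w ≠ u := by rintro rfl; omega
        refine .inr ⟨w, hw, ?_, ?_, ?_, ?_⟩
        · rw [e4, if_neg hau, i₁]
        · rw [e10, e3, if_neg hwu]; exact i₂
        · rw [e3, if_neg hwu, e3, if_neg hau]; exact i₃
        · rw [e8, hcap']; exact i₄
  · simpa using e7
  · intro a _ b _ hab
    omega

/-- Advancing the clock before stamping the sink makes all earlier stamps stale, so marks need no
erasing. The loop ends after a full pass without extension, that is, when no arc of at least the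
scale leads from an unmarked to a marked vertex. -/
theorem scan_spec {B n k : ℕ} {σ₀ : Memory} (hB : (n + 2) * (n + 2) ≤ 2 ^ B)
    (hN : σ₀ 5 0 = (n + 2 : ℕ)) (hn : σ₀ 12 0 = n) (hle : ∀ u < n + 2, σ₀ 3 (u : ℕ) ≤ σ₀ 9 0)
    (hk : (n + 3) * ((n + 2) * (n + 2) + 1) ≤ k) : Wp B scan k (Scanned n σ₀) σ₀ := by
  refine Wp.write_seq (by simp [ok_const]) (by simp [ok_var, ok_const, ok_add]) ?_
  refine Wp.write_seq (by simp [ok_const]) (by simp [ok_var]) ?_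
  refine Wp.write_seq (by simp [ok_var, ok_const, ok_add]) (by simp [ok_var]) ?_
  refine Wp.write_seq (by simp [ok_const]) (by simp [ok_const]) ?_
  simp only [eval_const, eval_var, eval_add, Memory.store_apply, hn]
  norm_num only [true_and, if_true, if_false, and_true, false_and, reduceIte]
  set σ₁ := (((σ₀.store 9 0 (σ₀ 9 0 + 1)).store 10 0 (σ₀ 9 0 + 1)).store 3 (n + 1)
    (σ₀ 9 0 + 1)).store 7 0 0 with hσ₁
  have harr : ∀ a, a ≠ 3 → a ≠ 7 → a ≠ 9 → a ≠ 10 → σ₁ a = σ₀ a := by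
    intro a h₁ h₂ h₃ h₄
    funext i
    simp [hσ₁, Memory.store_apply, h₁, h₂, h₃, h₄]
  have e9 : σ₁ 9 0 = σ₀ 9 0 + 1 := by simp [hσ₁, Memory.store_apply]
  have e10 : σ₁ 10 0 = σ₀ 9 0 + 1 := by simp [hσ₁, Memory.store_apply]
  have e3 : ∀ a : ℕ, σ₁ 3 a = if a = n + 1 then σ₀ 9 0 + 1 else σ₀ 3 a := by
    intro a
    have : (a : ℤ) = n + 1 ↔ a = n + 1 := by exact_mod_cast Iff.rfl
    simp [hσ₁, Memory.store_apply, this]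
  have e5 := harr 5 (by decide) (by decide) (by decide) (by decide)
  refine Wp.loop (ScanInv n σ₁) 0 ?_ ?_ ?_ _ ⟨rfl, rfl, rfl, rfl, rfl, ?_, ?_, ?_, ?_, 0, ?_, ?_, ?_, rfl⟩ ?_
  · intro m σ h
    have := congrFun h.order 0
    simp only [ok_sub, ok_mul, ok_var, eval_var, this, e5, hN, true_and, and_true]
    rw [← Nat.cast_mul, Int.natAbs_natCast]
    exact hB
  · intro m σ h hpos
    refine scanBody_spec hB (by rw [e5, hN]) h ?_
    rw [eval_sub, eval_mul, eval_var, eval_var, h.order, e5, hN] at hpos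
    push_cast at hpos ⊢
    linarith
  · rintro m σ ⟨h2, h5, h8, h10, h12, hT, hle, hsink, hlink, p, hpN, hσp, hclosed, hm⟩ hpos
    rw [eval_sub, eval_mul, eval_var, eval_var, h5, e5, hN, hσp] at hpos
    have hp : (n + 2) * (n + 2) ≤ p := by zify; push_cast at hpos; linarith
    refine ⟨?_, ?_, ?_, ?_, hle, hsink, hlink, fun u hu v hv => hclosed u hu v hv ?_⟩
    · rw [h2]; exact harr 2 (by decide) (by decide) (by decide) (by decide)
    · rw [h5]; exact harr 5 (by decide) (by decide) (by decide) (by decide)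
    · rw [h8]; exact harr 8 (by decide) (by decide) (by decide) (by decide)
    · rw [h12]; exact harr 12 (by decide) (by decide) (by decide) (by decide)
    · nlinarith
  · rw [e9, e10]
  · intro u hu
    have := hle u hu
    rw [e3, e9]
    split_ifs <;> omega
  · rw [e3, e10, if_pos rfl]
  · intro u hu
    have := hle u hu
    rw [e3, e10]
    split_ifs with h
    · exact fun _ => .inl h
    · omega
  · exact Nat.zero_le _
  · simp [hσ₁, Memory.store_apply]
  · intro a _ b _ hab
    omega
  · have : (unmarked n σ₁).card ≤ n + 2 :=
      (Finset.card_le_card (Finset.filter_subset _ _)).trans (by rw [Finset.card_range])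
    rw [zero_add, mul_one, Nat.sub_zero]
    refine le_trans ?_ hk
    generalize (n + 2) * (n + 2) = M
    calc _ ≤ (n + 2) * (M + 1) + M := by gcongr
      _ ≤ (n + 3) * (M + 1) := by rw [show n + 3 = n + 2 + 1 from rfl, Nat.succ_mul (n + 2)]; omega

/-! ### The scaling loop -/

/-- The source side of the cut that the program has found: the vertices that are not marked. -/
def sourceSide (σ : Memory) (u : ℕ) : Bool := decide (σ 3 u < σ 10 0)

/-- The invariant of the main loop; `c₀` is the initial capacity matrix. -/
structure MainInv (n : ℕ) (c₀ : ℕ → ℕ → ℤ) (m : ℕ) (σ : Memory) : Prop where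
  order : σ 5 0 = (n + 2 : ℕ)
  players : σ 12 0 = n
  scale_nonneg : 0 ≤ σ 8 0
  stamp_le : ∀ u < n + 2, σ 3 (u : ℕ) ≤ σ 9 0
  cap_nonneg : ∀ u < n + 2, ∀ v < n + 2, 0 ≤ cap (n + 2) σ u v
  cut : ∃ K : ℤ, ∀ S : ℕ → Bool, S n = true → S (n + 1) = false →
    cutValue (n + 2) c₀ S = cutValue (n + 2) (cap (n + 2) σ) S + K
  fuel : 0 < σ 8 0 → ∃ (q : ℕ) (S : ℕ → Bool), S n = true ∧ S (n + 1) = false ∧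
    cutValue (n + 2) (cap (n + 2) σ) S < (q + 1) * σ 8 0 ∧
    m = Nat.log 2 (σ 8 0).toNat * (2 * ((n + 2) * (n + 2)) + 1) + q + 1
  final : σ 8 0 = 0 → sourceSide σ n = true ∧ sourceSide σ (n + 1) = false ∧
    cutValue (n + 2) (cap (n + 2) σ) (sourceSide σ) ≤ 0

/-- The number `q` bounds the augmentations left at the current scale, because some separating cut
has capacity below `(q + 1)Δ` and every augmentation lowers it by `Δ`. Halving resets `q` to `2N²`,
which is paid for by the decrease of the logarithm. -/
theorem phaseBody_spec {B n m : ℕ} {c₀ : ℕ → ℕ → ℤ} {σ : Memory} (hB : (n + 2) * (n + 2) ≤ 2 ^ B)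
    (h : MainInv n c₀ m σ) (hΔ : 0 < σ 8 0) :
    Wp B phaseBody ((n + 3) * ((n + 2) * (n + 2) + 1) + (n + 2))
      (fun σ' => ∃ m' < m, MainInv n c₀ m' σ') σ := by
  obtain ⟨h5, h12, -, hle, hcap, ⟨K, hK⟩, hfuel, -⟩ := h
  obtain ⟨q, S, hs, ht, hS, hm⟩ := hfuel hΔ
  refine Wp.seq ((scan_spec hB h5 h12 hle le_rfl).mono le_rfl ?_) le_rfl
  intro σ₁ h₁
  have hc₁ : cap (n + 2) σ₁ = cap (n + 2) σ := cap_congr h₁.matrix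
  have g5 : σ₁ 5 0 = (n + 2 : ℕ) := by rw [h₁.order, h5]
  have g8 : σ₁ 8 0 = σ 8 0 := by rw [h₁.scale]
  have g12 : σ₁ 12 0 = n := by rw [h₁.players, h12]
  refine Wp.ite (by simp [ok_var, ok_read, ok_const, ok_add, ok_sub]) ?_ ?_
  · simp only [eval_add, eval_sub, eval_read, eval_var, eval_const, g12]
    intro hmark
    refine (walk_spec hB g5 g12 (by omega) (by rwa [hc₁]) h₁.link (by omega) le_rfl).mono le_rfl ?_
    rintro σ₂ ⟨i3, i5, i8, i9, -, i12, hcap₂, hcut⟩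
    rw [hc₁, g8] at hcut
    have g8' : σ₂ 8 0 = σ 8 0 := by rw [i8, g8]
    have hS₂ := hcut S hs ht
    have h0 := cutValue_nonneg hcap₂ S
    -- With `q = 0` the witnessing cut is below one unit, and the augmentation would make it
    -- negative.
    obtain ⟨q, rfl⟩ : ∃ q', q = q' + 1 := by
      refine ⟨q - 1, (Nat.succ_pred_eq_of_ne_zero ?_).symm⟩
      rintro rfl
      simp only [Nat.cast_zero, zero_add, one_mul] at hS
      omega
    refine ⟨m - 1, by omega, ⟨by rw [i5, g5], by rw [i12, g12], by omega, ?_, hcap₂,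
      ⟨K + σ 8 0, ?_⟩, fun _ => ⟨q, S, hs, ht, ?_, ?_⟩, fun h => by omega⟩⟩
    · rw [i3, i9]; exact h₁.stamp_le
    · intro S hs ht
      rw [hK S hs ht, ← hcut S hs ht]; ring
    · rw [g8']
      push_cast at hS
      linarith
    · rw [g8', hm]; omega
  · simp only [eval_add, eval_sub, eval_read, eval_var, eval_const, g12]
    intro hmark
    refine Wp.write (by simp [ok_const]) (by simp [ok_var, ok_const, ok_div]) ?_
    simp only [eval_const, eval_var, eval_div, g8]
    set σ₂ := σ₁.store 8 0 (σ 8 0 / 2) with hσ₂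
    have harr : ∀ a, a ≠ 8 → σ₂ a = σ₁ a := by
      intro a h; funext i; simp [hσ₂, Memory.store_apply, h]
    have i8 : σ₂ 8 0 = σ 8 0 / 2 := by simp [hσ₂, Memory.store_apply]
    have hc₂ : cap (n + 2) σ₂ = cap (n + 2) σ := by rw [← hc₁]; exact cap_congr (harr 2 (by decide))
    have hside : sourceSide σ₂ = sourceSide σ₁ := by
      unfold sourceSide; rw [harr 3 (by decide), harr 10 (by decide)]
    have hsource : sourceSide σ₂ n = true := by
      rw [hside, sourceSide, decide_eq_true_iff]; omega
    have hsink : sourceSide σ₂ (n + 1) = false := by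
      rw [hside, sourceSide, decide_eq_false_iff_not, not_lt]; exact h₁.sink
    have hcut : cutValue (n + 2) (cap (n + 2) σ) (sourceSide σ₂) ≤
        ((n + 2) * (n + 2) : ℕ) * (σ 8 0 - 1) := by
      refine cutValue_le (by omega) fun u hu v hv hu' hv' => ?_
      rw [hside, sourceSide, decide_eq_true_iff] at hu'
      rw [hside, sourceSide, decide_eq_false_iff_not, not_lt] at hv'
      have := h₁.closed u hu v hv hu' hv'
      rw [hc₁, g8] at this
      omega
    have hinv : ∀ m' : ℕ, (0 < σ 8 0 / 2 → m' = Nat.log 2 (σ 8 0 / 2).toNat *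
        (2 * ((n + 2) * (n + 2)) + 1) + 2 * ((n + 2) * (n + 2)) + 1) → MainInv n c₀ m' σ₂ := by
      intro m' hm'
      refine ⟨by rw [harr 5 (by decide), g5], by rw [harr 12 (by decide), g12], by omega, ?_,
        by rwa [hc₂], ⟨K, by rwa [hc₂]⟩, fun hpos => ⟨2 * ((n + 2) * (n + 2)), sourceSide σ₂,
          hsource, hsink, ?_, ?_⟩, fun hz => ⟨hsource, hsink, ?_⟩⟩
      · rw [harr 3 (by decide), harr 9 (by decide)]; exact h₁.stamp_le
      · rw [hc₂]
        refine hcut.trans_lt ?_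
        rw [i8] at hpos ⊢
        -- Integrality absorbs the rounding: all arcs of the new cut have capacity at most `Δ - 1`.
        have : σ 8 0 - 1 ≤ 2 * (σ 8 0 / 2) := by omega
        have := mul_le_mul_of_nonneg_left this (Int.natCast_nonneg ((n + 2) * (n + 2)))
        push_cast at this ⊢
        linarith
      · rw [i8] at hpos ⊢
        exact hm' hpos
      · rw [hc₂]
        refine hcut.trans (mul_nonpos_of_nonneg_of_nonpos (Int.natCast_nonneg _) ?_)
        omega
    by_cases hpos : 0 < σ 8 0 / 2
    · refine ⟨_, ?_, hinv _ fun _ => rfl⟩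
      rw [hm]
      have h₂ : (σ 8 0 / 2).toNat = (σ 8 0).toNat / 2 := by omega
      have h₃ : 0 < Nat.log 2 (σ 8 0).toNat := Nat.log_pos (by norm_num) (by omega)
      rw [h₂, Nat.log_div_base]
      obtain ⟨l, hl⟩ := Nat.exists_eq_succ_of_ne_zero h₃.ne'
      rw [hl, Nat.succ_sub_one, Nat.succ_mul l]
      omega
    -- The scale was `1` and is now `0`, so the loop stops and no fuel is needed.
    · exact ⟨0, by omega, hinv _ fun h => absurd h hpos⟩

/-- At scale `0` the cut that was found has residual capacity at most `0`, and all others have at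
least `0`. The constant `K` transfers the comparison to the initial capacities. -/
theorem main_spec {B n m k : ℕ} {c₀ : ℕ → ℕ → ℤ} {σ : Memory} (hB : (n + 2) * (n + 2) ≤ 2 ^ B)
    (h : MainInv n c₀ m σ)
    (hk : m * ((n + 3) * ((n + 2) * (n + 2) + 1) + (n + 2) + 1) ≤ k) :
    Wp B (.loop (var 8) phaseBody) k (fun σ' => σ' 12 0 = n ∧
      sourceSide σ' n = true ∧ sourceSide σ' (n + 1) = false ∧ ∀ S : ℕ → Bool, S n = true →
      S (n + 1) = false → cutValue (n + 2) c₀ (sourceSide σ') ≤ cutValue (n + 2) c₀ S) σ := by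
  refine Wp.loop (MainInv n c₀) _ (fun _ _ _ => by simp [ok_var])
    (fun m σ h hpos => phaseBody_spec hB h hpos) ?_ m h hk
  rintro m σ ⟨h5, h12, h8, hle, hcap, ⟨K, hK⟩, hfuel, hfinal⟩ hz
  obtain ⟨hs, ht, h0⟩ := hfinal (le_antisymm hz h8)
  refine ⟨h12, hs, ht, fun S hs' ht' => ?_⟩
  rw [hK _ hs ht, hK S hs' ht']
  have := cutValue_nonneg hcap S
  omega

/-! ### Common denominator, network and output -/

/-- The entry with offset `r` in the block of the input that is selected by the counter. -/
def entry (r : ℤ) : Expr := .read 0 (.const 9 * var 7 + .const r)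

theorem eval_entry (r : ℤ) (σ : Memory) : (entry r).eval σ = σ 0 (9 * σ 7 0 + r) := rfl

theorem ok_entry {B : ℕ} {σ : Memory} {q : ℕ} (r : ℤ) (hq : σ 7 0 = q) (h : 9 * q ≤ 2 ^ B) :
    (entry r).Ok B σ := by
  unfold entry
  simp only [ok_read, ok_add, ok_mul, ok_const, ok_var, eval_const, eval_var, hq, true_and, and_true]
  omega

/-- Multiplies the denominators of one block to the common denominator. -/
def denominatorBody : Program :=
  .seq (.write 6 (.const 0) (var 6 * entry 3 * entry 5 * entry 7 * entry 9)) <|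
  .write 7 (.const 0) (var 7 + .const 1)

/-- Computes a common denominator of all payoffs. -/
def denominator : Program :=
  .seq (.write 6 (.const 0) (.const 1)) <|
  .seq (.write 7 (.const 0) (.const 0)) <|
  .loop (var 12 * var 12 - var 7) denominatorBody

/-- Adds the capacities that come from one block. -/
def capacityBody : Program :=
  .seq (.write 13 (.const 0) (var 7 / var 12)) <|
  .seq (.write 14 (.const 0) (var 7 - var 13 * var 12)) <|
  .seq (.write 15 (.const 0) (var 6 * entry 2 / entry 3 - var 6 * entry 6 / entry 7)) <|
  .seq (.write 16 (.const 0) (var 6 * entry 8 / entry 9 - var 6 * entry 4 / entry 5)) <|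
  .seq (.write 2 (var 13 * var 5 + var 14)
    (.read 2 (var 13 * var 5 + var 14) + (var 15 + var 16))) <|
  .seq (.write 2 (var 13 * var 5 + (var 12 + .const 1))
    (.read 2 (var 13 * var 5 + (var 12 + .const 1)) + var 15)) <|
  .seq (.write 2 (var 12 * var 5 + var 13) (.read 2 (var 12 * var 5 + var 13) + var 16)) <|
  .seq (.write 8 (.const 0) (var 8 + var 16)) <|
  .write 7 (.const 0) (var 7 + .const 1)

/-- Builds the capacity matrix; the initial scale is larger than the capacity of the cut around the
source. -/
def capacities : Program :=
  .seq (.write 8 (.const 0) (.const 1)) <|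
  .seq (.write 7 (.const 0) (.const 0)) <|
  .loop (var 12 * var 12 - var 7) capacityBody

/-- Writes the action of one player. -/
def resultBody : Program :=
  .seq (.ite (var 10 - .read 3 (var 7)) (.write 0 (var 7) (.const 1)) (.write 0 (var 7) (.const 0))) <|
  .write 7 (.const 0) (var 7 + .const 1)

/-- Writes the output. -/
def result : Program :=
  .seq (.write 1 (.const 0) (var 12)) <|
  .seq (.write 7 (.const 0) (.const 0)) <|
  .loop (var 12 - var 7) resultBody

/-- The whole program. -/
def program : Program :=
  .seq (.write 12 (.const 0) (.read 0 (.const 0))) <|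
  .seq (.write 5 (.const 0) (var 12 + .const 2)) <|
  .seq denominator <|
  .seq capacities <|
  .seq (.loop (var 8) phaseBody) result

/-- The product of the denominators of a block. -/
def blockDen (inp : ℤ → ℤ) (q : ℕ) : ℤ :=
  inp (9 * q + 3) * inp (9 * q + 5) * inp (9 * q + 7) * inp (9 * q + 9)

/-- The exponent `β q` stands for the bits of the input before block `q`. Multiplying by the
denominators of a block uses no more bits than the block contains, so the plain product stays within
the input size and no gcd is required. -/
theorem denominator_spec {B I n k : ℕ} {σ₀ : Memory} (hB : 9 * (n * n) ≤ 2 ^ B) (hI : I ≤ B)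
    (hn : σ₀ 12 0 = n) (β : ℕ → ℕ) (hβI : ∀ q ≤ n * n, β q ≤ I)
    (hden : ∀ q < n * n, 0 < σ₀ 0 (9 * q + 3) ∧ 0 < σ₀ 0 (9 * q + 5) ∧ 0 < σ₀ 0 (9 * q + 7) ∧
      0 < σ₀ 0 (9 * q + 9))
    (hβ : ∀ q < n * n, 2 ^ β q * blockDen (σ₀ 0) q ≤ 2 ^ β (q + 1)) (hk : n * n ≤ k) :
    Wp B denominator k (fun σ => (∀ a, a ≠ 6 → a ≠ 7 → σ a = σ₀ a) ∧ 0 < σ 6 0 ∧ σ 6 0 ≤ 2 ^ I ∧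
      ∀ q < n * n, blockDen (σ₀ 0) q ∣ σ 6 0) σ₀ := by
  refine Wp.write_seq (by simp [ok_const]) (by simp [ok_const]) ?_
  refine Wp.write_seq (by simp [ok_const]) (by simp [ok_const]) ?_
  simp only [eval_const]
  refine Wp.loop (fun m σ => (∀ a, a ≠ 6 → a ≠ 7 → σ a = σ₀ a) ∧ 0 < σ 6 0 ∧
    ∃ q ≤ n * n, σ 7 0 = (q : ℕ) ∧ σ 6 0 ≤ 2 ^ β q ∧ (∀ q' < q, blockDen (σ₀ 0) q' ∣ σ 6 0) ∧
      m = n * n - q) 0 ?_ ?_ ?_ (n * n) ?_ (by omega)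
  · rintro m σ ⟨hf, -⟩
    simp only [ok_sub, ok_mul, ok_var, eval_var, hf 12 (by decide) (by decide), hn, true_and, and_true]
    rw [← Nat.cast_mul, Int.natAbs_natCast]
    omega
  · rintro m σ ⟨hf, hD, q, hq, hσq, hDβ, hdvd, hm⟩ hpos
    rw [eval_sub, eval_mul, eval_var, eval_var, hf 12 (by decide) (by decide), hn, hσq] at hpos
    have hqn : q < n * n := by zify; linarith
    have f0 := hf 0 (by decide) (by decide)
    obtain ⟨d₁, d₂, d₃, d₄⟩ := hden q hqn
    have hle : σ 6 0 * blockDen (σ₀ 0) q ≤ 2 ^ B := by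
      refine le_trans ?_ ((hβ q hqn).trans
        (pow_le_pow_right₀ (by norm_num) ((hβI (q + 1) hqn).trans hI)))
      exact mul_le_mul_of_nonneg_right hDβ (by unfold blockDen; positivity)
    have hent : ∀ r, (entry r).Ok B σ := fun r => ok_entry r hσq (by omega)
    unfold denominatorBody
    -- Each partial product `a` has a positive integral cofactor `b` in the full product, so it
    -- obeys the same bound.
    have hle' : ∀ a b : ℤ, 0 ≤ a → 0 < b → a * b = σ 6 0 * blockDen (σ₀ 0) q →
        a.natAbs ≤ 2 ^ B := by
      intro a b ha hb hab
      zify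
      rw [abs_of_nonneg ha]
      refine le_trans ?_ hle
      rw [← hab]
      nlinarith
    refine Wp.write_seq (by simp [ok_const]) ?_ ?_
    · simp only [ok_mul, ok_var, hent, true_and, eval_mul, eval_var, eval_entry, hσq, f0]
      refine ⟨⟨⟨?_, ?_⟩, ?_⟩, ?_⟩
      · exact hle' _ (σ₀ 0 (9 * q + 5) * σ₀ 0 (9 * q + 7) * σ₀ 0 (9 * q + 9)) (by positivity)
          (by positivity) (by unfold blockDen; ring)
      · exact hle' _ (σ₀ 0 (9 * q + 7) * σ₀ 0 (9 * q + 9)) (by positivity)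
          (by positivity) (by unfold blockDen; ring)
      · exact hle' _ (σ₀ 0 (9 * q + 9)) (by positivity) (by positivity) (by unfold blockDen; ring)
      · exact hle' _ 1 (by positivity) (by positivity) (by unfold blockDen; ring)
    refine Wp.write (by simp [ok_const]) (by simp [ok_const, ok_var, ok_add]) ?_
    simp only [eval_const, eval_add, eval_mul, eval_var, eval_entry, hσq, f0]
    set D := σ 6 0 * σ₀ 0 (9 * q + 3) * σ₀ 0 (9 * q + 5) * σ₀ 0 (9 * q + 7) * σ₀ 0 (9 * q + 9) with hDdef
    have hD' : D = σ 6 0 * blockDen (σ₀ 0) q := by rw [hDdef]; unfold blockDen; ring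
    have e6 : ((σ.store 6 0 D).store 7 0 ((σ.store 6 0 D) 7 0 + 1)) 6 0 = D := by
      simp [Memory.store_apply]
    refine ⟨_, ?_, ?_, ?_, q + 1, hqn, ?_, ?_, ?_, rfl⟩
    · omega
    · intro a h₁ h₂
      funext i
      simp [Memory.store_apply, h₁, h₂, hf a h₁ h₂]
    · rw [e6, hDdef]; positivity
    · simp [Memory.store_apply, hσq]
    · rw [e6, hD']
      refine le_trans ?_ (hβ q hqn)
      exact mul_le_mul_of_nonneg_right hDβ (by unfold blockDen; positivity)
    · intro q' hq'
      rw [e6, hD']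
      rcases Nat.lt_succ_iff_lt_or_eq.1 hq' with h | rfl
      · exact (hdvd q' h).mul_right _
      · exact Dvd.intro_left _ rfl
  · rintro m σ ⟨hf, hD, q, hq, hσq, hDβ, hdvd, hm⟩ hpos
    rw [eval_sub, eval_mul, eval_var, eval_var, hf 12 (by decide) (by decide), hn, hσq] at hpos
    have hqn : q = n * n := by apply le_antisymm hq; zify; linarith
    subst hqn
    exact ⟨hf, hD, hDβ.trans (pow_le_pow_right₀ (by norm_num) (hβI _ le_rfl)), hdvd⟩
  · refine ⟨?_, ?_, 0, Nat.zero_le _, ?_, ?_, ?_, rfl⟩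
    · intro a h₁ h₂
      funext i
      simp [Memory.store_apply, h₁, h₂]
    · simp [Memory.store_apply]
    · simp [Memory.store_apply]
    · simpa [Memory.store_apply] using (one_le_pow₀ (by norm_num) : (1 : ℤ) ≤ 2 ^ β 0)
    · intro q hq
      omega

/-- The loss of player `i` when `(1, 1)` changes to `(2, 1)` in the block `q = (i, j)`, times `D`. -/
def lossOne (inp : ℤ → ℤ) (D : ℤ) (q : ℕ) : ℤ :=
  D * inp (9 * q + 2) / inp (9 * q + 3) - D * inp (9 * q + 6) / inp (9 * q + 7)

/-- The loss of player `i` when `(2, 2)` changes to `(1, 2)` in the block `q = (i, j)`, times `D`. -/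
def lossTwo (inp : ℤ → ℤ) (D : ℤ) (q : ℕ) : ℤ :=
  D * inp (9 * q + 8) / inp (9 * q + 9) - D * inp (9 * q + 4) / inp (9 * q + 5)

/-- The contribution of a block to the capacity of the cut around `S`. -/
def blockCut (n : ℕ) (y z : ℕ → ℤ) (S : ℕ → Bool) (q : ℕ) : ℤ :=
  (if S (q / n) = true ∧ S (q % n) = false then y q + z q else 0) +
    (if S (q / n) = true then y q else 0) + (if S (q / n) = false then z q else 0)

/-- The invariant of the construction of the capacity matrix. -/
structure CapacityInv (n : ℕ) (σ₀ : Memory) (m : ℕ) (σ : Memory) : Prop where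
  frame : ∀ a, a ≠ 2 → a ≠ 7 → a ≠ 8 → a ≠ 13 → a ≠ 14 → a ≠ 15 → a ≠ 16 → σ a = σ₀ a
  cap_nonneg : ∀ u < n + 2, ∀ v < n + 2, 0 ≤ cap (n + 2) σ u v
  counter : ∃ q ≤ n * n, σ 7 0 = (q : ℕ) ∧
    σ 8 0 = 1 + ∑ q' ∈ Finset.range q, lossTwo (σ₀ 0) (σ₀ 6 0) q' ∧
    (∀ S : ℕ → Bool, S n = true → S (n + 1) = false → cutValue (n + 2) (cap (n + 2) σ) S =
      ∑ q' ∈ Finset.range q, blockCut n (lossOne (σ₀ 0) (σ₀ 6 0)) (lossTwo (σ₀ 0) (σ₀ 6 0)) S q') ∧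
    m = n * n - q

/-- The three arcs that receive capacity produce the three summands of `blockCut`: player to player,
player to sink, source to player. Since capacities are added to the cells, blocks sharing an arc
accumulate. -/
theorem capacityBody_spec {B n m : ℕ} {σ₀ σ : Memory} (hB : 9 * (n * n) ≤ 2 ^ B)
    (hB' : (n + 2) * (n + 2) ≤ 2 ^ B) (hN : σ₀ 5 0 = (n + 2 : ℕ)) (hn : σ₀ 12 0 = n)
    (hmul : ∀ i, (σ₀ 6 0 * σ₀ 0 i).natAbs ≤ 2 ^ B)
    (hy : ∀ q < n * n, 0 ≤ lossOne (σ₀ 0) (σ₀ 6 0) q) (hz : ∀ q < n * n, 0 ≤ lossTwo (σ₀ 0) (σ₀ 6 0) q)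
    (h : CapacityInv n σ₀ m σ) (hpos : σ 7 0 < (n * n : ℕ)) :
    Wp B capacityBody 0 (fun σ' => ∃ m' < m, CapacityInv n σ₀ m' σ') σ := by
  obtain ⟨hf, hcap, q, hq, hσq, h8, hcut, hm⟩ := h
  rw [hσq, Nat.cast_lt] at hpos
  have hn0 : 0 < n := Nat.pos_of_ne_zero (by rintro rfl; simp at hpos)
  set u := q / n with hu
  set v := q % n with hv
  have hun : u < n := Nat.div_lt_of_lt_mul hpos
  have hvn : v < n := Nat.mod_lt _ hn0
  have hquv : (q : ℤ) - u * n = v := by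
    have := Nat.div_add_mod' q n
    rw [← hu, ← hv] at this
    rw [← this]; push_cast; ring
  set y := lossOne (σ₀ 0) (σ₀ 6 0) q with hydef
  set z := lossTwo (σ₀ 0) (σ₀ 6 0) q with hzdef
  have hy0 : 0 ≤ y := hy q hpos
  have hz0 : 0 ≤ z := hz q hpos
  have f0 : σ 0 = σ₀ 0 := hf 0 (by decide) (by decide) (by decide) (by decide) (by decide) (by decide) (by decide)
  have f5 : σ 5 = σ₀ 5 := hf 5 (by decide) (by decide) (by decide) (by decide) (by decide) (by decide) (by decide)
  have f6 : σ 6 = σ₀ 6 := hf 6 (by decide) (by decide) (by decide) (by decide) (by decide) (by decide) (by decide)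
  have f12 : σ 12 0 = n := by
    rw [hf 12 (by decide) (by decide) (by decide) (by decide) (by decide) (by decide) (by decide), hn]
  have hmulN : ∀ a < n + 2, ((a : ℤ) * ((n + 2 : ℕ) : ℤ)).natAbs ≤ 2 ^ B := fun a ha => by
    rw [← Nat.cast_mul, Int.natAbs_natCast]
    exact (Nat.mul_le_mul_right _ ha.le).trans hB'
  have hmuln : ((u : ℤ) * n).natAbs ≤ 2 ^ B := by
    rw [← Nat.cast_mul, Int.natAbs_natCast]
    nlinarith
  refine Wp.write_seq (by simp [ok_const]) (by simp [ok_var, ok_div]) ?_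
  simp only [eval_const, eval_var, eval_div, hσq, f12]
  rw [← Int.natCast_div, ← hu]
  set σ₁ := σ.store 13 0 u with hσ₁
  have a₁ : ∀ a, a ≠ 13 → σ₁ a = σ a := by
    intro a h; funext i; simp [hσ₁, Memory.store_apply, h]
  have a₂ : σ₁ 13 0 = u := by simp [hσ₁, Memory.store_apply]
  refine Wp.write_seq (by simp [ok_const]) ?_ ?_
  · simpa [ok_var, ok_sub, ok_mul, eval_var, a₁, a₂, f12] using hmuln
  simp only [eval_const, eval_var, eval_sub, eval_mul, a₁ 12 (by decide), a₁ 7 (by decide), a₂, hσq, f12,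
    hquv]
  set σ₂ := σ₁.store 14 0 v with hσ₂
  have b₁ : ∀ a, a ≠ 13 → a ≠ 14 → σ₂ a = σ a := by
    intro a h h'; funext i; simp [hσ₂, Memory.store_apply, h', a₁ a h]
  have b13 : σ₂ 13 0 = u := by simp [hσ₂, Memory.store_apply, a₂]
  have b14 : σ₂ 14 0 = v := by simp [hσ₂, Memory.store_apply]
  have b7 : σ₂ 7 0 = q := by rw [b₁ 7 (by decide) (by decide), hσq]
  have b0 : σ₂ 0 = σ₀ 0 := by rw [b₁ 0 (by decide) (by decide), f0]
  have b6 : σ₂ 6 = σ₀ 6 := by rw [b₁ 6 (by decide) (by decide), f6]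
  have hentry : ∀ {σ' : Memory}, σ' 7 0 = q → ∀ r, (entry r).Ok B σ' :=
    fun h r => ok_entry r h (by omega)
  refine Wp.write_seq (by simp [ok_const]) ?_ ?_
  · simp only [ok_sub, ok_div, ok_mul, ok_var, hentry b7, eval_var, eval_entry, b0, b6, hmul, and_self]
  rw [show (var 6 * entry 2 / entry 3 - var 6 * entry 6 / entry 7).eval σ₂ = y by
    simp only [eval_sub, eval_div, eval_mul, eval_var, eval_entry, b0, b6, b7]; rfl, eval_const]
  set σ₃ := σ₂.store 15 0 y with hσ₃
  have c₁ : ∀ a, a ≠ 15 → σ₃ a = σ₂ a := by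
    intro a h; funext i; simp [hσ₃, Memory.store_apply, h]
  have c7 : σ₃ 7 0 = q := by rw [c₁ 7 (by decide), b7]
  refine Wp.write_seq (by simp [ok_const]) ?_ ?_
  · simp only [ok_sub, ok_div, ok_mul, ok_var, hentry c7, eval_var, eval_entry, c₁ 0 (by decide),
      c₁ 6 (by decide), b0, b6, hmul, and_self]
  rw [show (var 6 * entry 8 / entry 9 - var 6 * entry 4 / entry 5).eval σ₃ = z by
    simp only [eval_sub, eval_div, eval_mul, eval_var, eval_entry, c₁ 0 (by decide),
      c₁ 6 (by decide), b0, b6, c7]; rfl, eval_const]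
  set σ₄ := σ₃.store 16 0 z with hσ₄
  have d₁ : ∀ a, a ≠ 13 → a ≠ 14 → a ≠ 15 → a ≠ 16 → σ₄ a = σ a := by
    intro a h₁ h₂ h₃ h₄
    rw [← b₁ a h₁ h₂, ← c₁ a h₃]; funext i; simp [hσ₄, Memory.store_apply, h₄]
  have d13 : σ₄ 13 0 = u := by simp [hσ₄, hσ₃, Memory.store_apply, b13]
  have d14 : σ₄ 14 0 = v := by simp [hσ₄, hσ₃, Memory.store_apply, b14]
  have d15 : σ₄ 15 0 = y := by simp [hσ₄, hσ₃, Memory.store_apply]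
  have d16 : σ₄ 16 0 = z := by simp [hσ₄, Memory.store_apply]
  have d5 : σ₄ 5 0 = (n + 2 : ℕ) := by
    rw [d₁ 5 (by decide) (by decide) (by decide) (by decide), f5, hN]
  have d12 : σ₄ 12 0 = n := by rw [d₁ 12 (by decide) (by decide) (by decide) (by decide), f12]
  have hstore : ∀ (σ' : Memory) (i w : ℤ) (a : ℕ), a ≠ 2 → (σ'.store 2 i w) a = σ' a := by
    intro σ' i w a h; funext j; simp [Memory.store_apply, h]
  refine Wp.write_seq ?_ ?_ ?_
  · simp only [ok_add, ok_mul, ok_var, eval_var, d13, d5, true_and, and_true]; exact hmulN u (by omega)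
  · simp only [ok_read, ok_add, ok_mul, ok_var, eval_var, d13, d5, true_and, and_true]
    exact hmulN u (by omega)
  simp only [eval_add, eval_mul, eval_var, eval_read, d13, d5, d14, d15, d16]
  set σ₅ := σ₄.store 2 ((u : ℤ) * (n + 2 : ℕ) + v) (σ₄ 2 ((u : ℤ) * (n + 2 : ℕ) + v) + (y + z)) with hσ₅
  have e₁ : ∀ a, a ≠ 2 → σ₅ a = σ₄ a := hstore _ _ _
  refine Wp.write_seq ?_ ?_ ?_
  · simp only [ok_add, ok_mul, ok_var, ok_const, eval_var, e₁ 13 (by decide), e₁ 5 (by decide), d13, d5,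
      true_and, and_true]
    exact hmulN u (by omega)
  · simp only [ok_read, ok_add, ok_mul, ok_var, ok_const, eval_var, e₁ 13 (by decide), e₁ 5 (by decide),
      d13, d5, true_and, and_true]
    exact hmulN u (by omega)
  simp only [eval_add, eval_mul, eval_var, eval_const, eval_read, e₁ 13 (by decide), e₁ 5 (by decide),
    e₁ 12 (by decide), e₁ 15 (by decide), d13, d5, d12, d15]
  rw [show (n : ℤ) + 1 = (n + 1 : ℕ) by push_cast; rfl]
  set σ₆ := σ₅.store 2 ((u : ℤ) * (n + 2 : ℕ) + (n + 1 : ℕ))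
    (σ₅ 2 ((u : ℤ) * (n + 2 : ℕ) + (n + 1 : ℕ)) + y) with hσ₆
  have g₁ : ∀ a, a ≠ 2 → σ₆ a = σ₄ a := fun a h => (hstore _ _ _ a h).trans (e₁ a h)
  refine Wp.write_seq ?_ ?_ ?_
  · simp only [ok_add, ok_mul, ok_var, eval_var, g₁ 12 (by decide), g₁ 5 (by decide), d12, d5,
      true_and, and_true]
    exact hmulN n (by omega)
  · simp only [ok_read, ok_add, ok_mul, ok_var, eval_var, g₁ 12 (by decide), g₁ 5 (by decide), d12, d5,
      true_and, and_true]
    exact hmulN n (by omega)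
  simp only [eval_add, eval_mul, eval_var, eval_read, g₁ 13 (by decide), g₁ 5 (by decide),
    g₁ 12 (by decide), g₁ 16 (by decide), d13, d5, d12, d16]
  set σ₇ := σ₆.store 2 ((n : ℤ) * (n + 2 : ℕ) + u) (σ₆ 2 ((n : ℤ) * (n + 2 : ℕ) + u) + z) with hσ₇
  have k₁ : ∀ a, a ≠ 2 → σ₇ a = σ₄ a := fun a h => (hstore _ _ _ a h).trans (g₁ a h)
  refine Wp.write_seq (by simp [ok_const]) (by simp [ok_var, ok_add]) ?_
  refine Wp.write (by simp [ok_const]) (by simp [ok_var, ok_const, ok_add]) ?_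
  simp only [eval_add, eval_var, eval_const, k₁ 8 (by decide), k₁ 16 (by decide), d16,
    d₁ 8 (by decide) (by decide) (by decide) (by decide)]
  have k7 : (σ₇.store 8 0 (σ 8 0 + z)) 7 0 = q := by
    simp [Memory.store_apply, k₁ 7 (by decide), d₁, hσq]
  rw [k7]
  set σ₉ := (σ₇.store 8 0 (σ 8 0 + z)).store 7 0 (q + 1) with hσ₉
  have hc₄ : cap (n + 2) σ₄ = cap (n + 2) σ :=
    cap_congr (d₁ 2 (by decide) (by decide) (by decide) (by decide))
  have hc₉ : cap (n + 2) σ₉ = cap (n + 2) σ₇ :=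
    cap_congr (by funext i; simp [hσ₉, Memory.store_apply])
  have hadd : ∀ {σ' : Memory} {s t : ℕ} (w : ℤ), s < n + 2 → t < n + 2 → ∀ a < n + 2, ∀ b < n + 2,
      cap (n + 2) (σ'.store 2 ((s : ℤ) * (n + 2 : ℕ) + t) (σ' 2 ((s : ℤ) * (n + 2 : ℕ) + t) + w)) a b =
        cap (n + 2) σ' a b + if a = s ∧ b = t then w else 0 := by
    intro σ' s t w hs ht a ha b hb
    rw [cap_store ht hb]
    split_ifs with h
    · rw [h.1, h.2]; simp only [cap]
    · rw [add_zero]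
  have hc₅ := hadd (σ' := σ₄) (s := u) (t := v) (y + z) (by omega) (by omega)
  have hc₆ := hadd (σ' := σ₅) (s := u) (t := n + 1) y (by omega) (by omega)
  have hc₇ := hadd (σ' := σ₆) (s := n) (t := u) z (by omega) (by omega)
  rw [← hσ₅] at hc₅
  rw [← hσ₆] at hc₆
  rw [← hσ₇] at hc₇
  refine ⟨_, ?_, ⟨?_, ?_, q + 1, hpos, ?_, ?_, ?_, rfl⟩⟩
  · omega
  · intro a h₁ h₂ h₃ h₄ h₅ h₆ h₇
    rw [← hf a h₁ h₂ h₃ h₄ h₅ h₆ h₇, ← d₁ a h₄ h₅ h₆ h₇, ← k₁ a h₁]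
    funext i
    simp [hσ₉, Memory.store_apply, h₂, h₃]
  · intro a ha b hb
    rw [hc₉, hc₇ a ha b hb, hc₆ a ha b hb, hc₅ a ha b hb, hc₄]
    have := hcap a ha b hb
    split_ifs <;> omega
  · simp [hσ₉, Memory.store_apply]
  · rw [Finset.sum_range_succ, ← add_assoc, ← h8, ← hzdef]
    simp [hσ₉, Memory.store_apply]
  · intro S hs ht
    rw [hc₉, cutValue_add_single (by omega) (by omega) hc₇, cutValue_add_single (by omega) (by omega) hc₆,
      cutValue_add_single (by omega) (by omega) hc₅, hc₄, hcut S hs ht, Finset.sum_range_succ]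
    simp only [blockCut, hs, ht, and_true, true_and]
    rw [← hu, ← hv, ← hydef, ← hzdef]
    ring

theorem capacities_spec {B n k : ℕ} {σ₀ : Memory} (hB : 9 * (n * n) ≤ 2 ^ B)
    (hB' : (n + 2) * (n + 2) ≤ 2 ^ B) (hN : σ₀ 5 0 = (n + 2 : ℕ)) (hn : σ₀ 12 0 = n)
    (h0 : ∀ i, σ₀ 2 i = 0) (hmul : ∀ i, (σ₀ 6 0 * σ₀ 0 i).natAbs ≤ 2 ^ B)
    (hy : ∀ q < n * n, 0 ≤ lossOne (σ₀ 0) (σ₀ 6 0) q)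
    (hz : ∀ q < n * n, 0 ≤ lossTwo (σ₀ 0) (σ₀ 6 0) q) (hk : n * n ≤ k) :
    Wp B capacities k (fun σ => σ 3 = σ₀ 3 ∧ σ 5 = σ₀ 5 ∧ σ 9 = σ₀ 9 ∧ σ 12 = σ₀ 12 ∧
      (∀ u < n + 2, ∀ v < n + 2, 0 ≤ cap (n + 2) σ u v) ∧
      σ 8 0 = 1 + ∑ q ∈ Finset.range (n * n), lossTwo (σ₀ 0) (σ₀ 6 0) q ∧
      ∀ S : ℕ → Bool, S n = true → S (n + 1) = false → cutValue (n + 2) (cap (n + 2) σ) S =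
        ∑ q ∈ Finset.range (n * n),
          blockCut n (lossOne (σ₀ 0) (σ₀ 6 0)) (lossTwo (σ₀ 0) (σ₀ 6 0)) S q) σ₀ := by
  refine Wp.write_seq (by simp [ok_const]) (by simp [ok_const]) ?_
  refine Wp.write_seq (by simp [ok_const]) (by simp [ok_const]) ?_
  simp only [eval_const]
  have hcap : ∀ u v, cap (n + 2) ((σ₀.store 8 0 1).store 7 0 0) u v = 0 := by
    intro u v
    simp [cap, Memory.store_apply, h0]
  have f12 : ∀ {m σ}, CapacityInv n σ₀ m σ → σ 12 = σ₀ 12 := fun h =>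
    h.frame 12 (by decide) (by decide) (by decide) (by decide) (by decide) (by decide) (by decide)
  refine Wp.loop (CapacityInv n σ₀) 0 ?_ ?_ ?_ (n * n) ⟨?_, ?_, 0, Nat.zero_le _, ?_, ?_, ?_, rfl⟩ (by omega)
  · intro m σ h
    simp only [ok_sub, ok_mul, ok_var, eval_var, f12 h, hn, true_and, and_true]
    rw [← Nat.cast_mul, Int.natAbs_natCast]
    omega
  · intro m σ h hpos
    rw [eval_sub, eval_mul, eval_var, eval_var, f12 h, hn] at hpos
    exact capacityBody_spec hB hB' hN hn hmul hy hz h (by push_cast; linarith)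
  · rintro m σ h hpos
    rw [eval_sub, eval_mul, eval_var, eval_var, f12 h, hn] at hpos
    obtain ⟨hf, hcap, q, hq, hσq, h8, hcut, hm⟩ := h
    have hqn : q = n * n := by apply le_antisymm hq; zify; linarith
    subst hqn
    exact ⟨hf 3 (by decide) (by decide) (by decide) (by decide) (by decide) (by decide) (by decide),
      hf 5 (by decide) (by decide) (by decide) (by decide) (by decide) (by decide) (by decide),
      hf 9 (by decide) (by decide) (by decide) (by decide) (by decide) (by decide) (by decide),
      hf 12 (by decide) (by decide) (by decide) (by decide) (by decide) (by decide) (by decide),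
      hcap, h8, hcut⟩
  · intro a h₁ h₂ h₃ _ _ _ _
    funext i
    simp [Memory.store_apply, h₂, h₃]
  · intro u _ v _
    exact (hcap u v).ge
  · simp [Memory.store_apply]
  · simp [Memory.store_apply]
  · intro S _ _
    simp [cutValue, hcap]

theorem result_spec {B n k : ℕ} {σ₀ : Memory} (hn : σ₀ 12 0 = n) (hk : n ≤ k) :
    Wp B result k (fun σ => σ 1 0 = n ∧ ∀ u < n, σ 0 (u : ℕ) = if sourceSide σ₀ u then 1 else 0) σ₀ := by
  refine Wp.write_seq (by simp [ok_const]) (by simp [ok_var]) ?_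
  refine Wp.write_seq (by simp [ok_const]) (by simp [ok_const]) ?_
  simp only [eval_const, eval_var]
  refine Wp.loop (fun m σ => (∀ a, a ≠ 0 → a ≠ 1 → a ≠ 7 → σ a = σ₀ a) ∧ σ 1 0 = n ∧
    ∃ p ≤ n, σ 7 0 = (p : ℕ) ∧ (∀ u < p, σ 0 (u : ℕ) = if sourceSide σ₀ u then 1 else 0) ∧ m = n - p)
    0 ?_ ?_ ?_ n ?_ (by omega)
  · intros; simp [ok_sub, ok_var]
  · rintro m σ ⟨hf, h1, p, hp, hσp, hout, hm⟩ hpos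
    have f12 := hf 12 (by decide) (by decide) (by decide)
    have f3 := hf 3 (by decide) (by decide) (by decide)
    have f10 := hf 10 (by decide) (by decide) (by decide)
    rw [eval_sub, eval_var, eval_var, f12, hn, hσp] at hpos
    have hpn : p < n := by omega
    have key : ∀ w : ℤ, w = (if sourceSide σ₀ p then 1 else 0) →
        Wp B (.write 7 (.const 0) (var 7 + .const 1)) 0 (fun σ' => ∃ m' < m,
          (∀ a, a ≠ 0 → a ≠ 1 → a ≠ 7 → σ' a = σ₀ a) ∧ σ' 1 0 = n ∧ ∃ p ≤ n, σ' 7 0 = (p : ℕ) ∧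
          (∀ u < p, σ' 0 (u : ℕ) = if sourceSide σ₀ u then 1 else 0) ∧ m' = n - p)
          (σ.store 0 p w) := by
      intro w hw
      refine Wp.write (by simp [ok_const]) (by simp [ok_var, ok_add, ok_const]) ?_
      refine ⟨_, ?_, ?_, ?_, p + 1, hpn, ?_, ?_, rfl⟩
      · omega
      · intro a h₁ h₂ h₃
        funext i
        simp [Memory.store_apply, h₁, h₃, hf a h₁ h₂ h₃]
      · simp [Memory.store_apply, h1]
      · simp [eval_add, eval_var, eval_const, Memory.store_apply, hσp]
      · intro u hu
        simp only [Memory.store_apply, show (0 : ℕ) ≠ 7 by decide, false_and, if_false, true_and,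
          Nat.cast_inj]
        by_cases h : u = p
        · rw [if_pos h, hw, h]
        · rw [if_neg h]
          exact hout u (by omega)
    unfold resultBody
    refine Wp.seq (k₁ := 0) (k₂ := 0) (Wp.ite (by simp [ok_sub, ok_var, ok_read]) ?_ ?_) le_rfl
    all_goals
      simp only [eval_sub, eval_var, eval_read, f3, f10, hσp]
      intro h
      refine Wp.write (by simp [ok_var]) (by simp [ok_const]) ?_
      simp only [eval_var, eval_const, hσp]
      refine key _ ?_
      simp only [sourceSide, decide_eq_true_eq]
      split_ifs <;> omega
  · rintro m σ ⟨hf, h1, p, hp, hσp, hout, hm⟩ hpos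
    rw [eval_sub, eval_var, eval_var, hf 12 (by decide) (by decide) (by decide), hn, hσp] at hpos
    exact ⟨h1, fun u hu => hout u (by omega)⟩
  · refine ⟨?_, ?_, 0, Nat.zero_le _, ?_, ?_, rfl⟩
    · intro a h₁ h₂ h₃
      funext i
      simp [Memory.store_apply, h₂, h₃]
    · simp [Memory.store_apply, hn]
    · simp [Memory.store_apply]
    · intro u hu
      omega

/-! ### The whole program -/

/-- A bound for the number of loop iterations of the program on inputs of size `I`. -/
def iterationBound (I : ℕ) : ℕ :=
  I + (I + (((3 * I + 2) * (2 * (I + 3) + 1) + 1) * ((I + 3) * (I + 3 + 1) + (I + 2) + 1) + I))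

/-- This is all that the game side needs from the machine side, stated for raw integers: if every
`D` clearing the denominators makes the losses nonnegative, the output is a minimum cut of the
network for one such `D`. -/
theorem program_spec {I n : ℕ} {σ₀ : Memory} (hI : 9 * (n * n) + 1 ≤ I) (hn : σ₀ 0 0 = n)
    (h2 : σ₀ 2 = 0) (h3 : σ₀ 3 = 0) (h9 : σ₀ 9 = 0) (hinp : ∀ i, (σ₀ 0 i).natAbs ≤ 2 ^ I)
    (β : ℕ → ℕ) (hβI : ∀ q ≤ n * n, β q ≤ I)
    (hden : ∀ q < n * n, 0 < σ₀ 0 (9 * q + 3) ∧ 0 < σ₀ 0 (9 * q + 5) ∧ 0 < σ₀ 0 (9 * q + 7) ∧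
      0 < σ₀ 0 (9 * q + 9))
    (hβ : ∀ q < n * n, 2 ^ β q * blockDen (σ₀ 0) q ≤ 2 ^ β (q + 1))
    (hloss : ∀ D > 0, ∀ q < n * n, blockDen (σ₀ 0) q ∣ D →
      0 ≤ lossOne (σ₀ 0) D q ∧ 0 ≤ lossTwo (σ₀ 0) D q) :
    Wp (2 * I + 3) program (iterationBound I) (fun σ => σ 1 0 = n ∧ ∃ (D : ℤ) (U : ℕ → Bool), 0 < D ∧
      (∀ q < n * n, blockDen (σ₀ 0) q ∣ D) ∧ (∀ u < n, σ 0 (u : ℕ) = if U u then 1 else 0) ∧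
      ∀ S : ℕ → Bool,
        ∑ q ∈ Finset.range (n * n), blockCut n (lossOne (σ₀ 0) D) (lossTwo (σ₀ 0) D) U q ≤
        ∑ q ∈ Finset.range (n * n), blockCut n (lossOne (σ₀ 0) D) (lossTwo (σ₀ 0) D) S q) σ₀ := by
  have hnn : n ≤ n * n := Nat.le_mul_self n
  -- In the exponent `2 * I + 3`, the part `2 * I` serves products of the denominator with an input
  -- number; the extra `3` leaves room for index products, even if `n = 0`.
  have hsq : (n + 2) * (n + 2) ≤ I + 3 := by nlinarith
  have hIB : I + 3 ≤ 2 ^ (2 * I + 3) :=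
    (Nat.lt_two_pow_self (n := I + 3)).le.trans (Nat.pow_le_pow_right (by norm_num) (by omega))
  unfold program iterationBound
  refine Wp.write_seq (by simp [ok_const]) (by simp [ok_read, ok_const]) ?_
  refine Wp.write_seq (by simp [ok_const]) (by simp [ok_var, ok_const, ok_add]) ?_
  simp only [eval_const, eval_read, eval_var, eval_add, hn]
  set σ₁ := (σ₀.store 12 0 n).store 5 0 ((σ₀.store 12 0 n) 12 0 + 2) with hσ₁
  have harr : ∀ a, a ≠ 5 → a ≠ 12 → σ₁ a = σ₀ a := by
    intro a h₁ h₂; funext i; simp [hσ₁, Memory.store_apply, h₁, h₂]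
  have a12 : σ₁ 12 0 = n := by simp [hσ₁, Memory.store_apply]
  have a5 : σ₁ 5 0 = (n + 2 : ℕ) := by simp [hσ₁, Memory.store_apply]
  have a0 := harr 0 (by decide) (by decide)
  refine Wp.seq ((denominator_spec (B := 2 * I + 3) (I := I) (by omega) (by omega) a12 β hβI
    (by rwa [a0]) (by rwa [a0]) (show n * n ≤ I by omega)).mono le_rfl ?_) le_rfl
  rintro σ₂ ⟨b, hD, hDI, hdvd⟩
  have b0 := b 0 (by decide) (by decide)
  rw [a0] at b0 hdvd
  have hmul : ∀ i, (σ₂ 6 0 * σ₂ 0 i).natAbs ≤ 2 ^ (2 * I) := by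
    intro i
    rw [Int.natAbs_mul, b0, two_mul, pow_add]
    refine Nat.mul_le_mul ?_ (hinp i)
    zify
    rwa [abs_of_pos hD]
  have hz₀ : ∀ q < n * n, 0 ≤ lossTwo (σ₂ 0) (σ₂ 6 0) q := fun q hq => by
    rw [b0]; exact (hloss _ hD q hq (hdvd q hq)).2
  refine Wp.seq ((capacities_spec (B := 2 * I + 3) (by omega) (by omega)
    (by rw [b 5 (by decide) (by decide), a5]) (by rw [b 12 (by decide) (by decide), a12])
    (fun i => by rw [b 2 (by decide) (by decide), harr 2 (by decide) (by decide), h2]; rfl)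
    (fun i => (hmul i).trans (Nat.pow_le_pow_right (by norm_num) (by omega)))
    (fun q hq => by rw [b0]; exact (hloss _ hD q hq (hdvd q hq)).1)
    hz₀ (show n * n ≤ I by omega)).mono le_rfl ?_) le_rfl
  rintro σ₃ ⟨c3, c5, c9, c12, hcap, c8, hcut⟩
  rw [b 3 (by decide) (by decide), harr 3 (by decide) (by decide), h3] at c3
  rw [b 9 (by decide) (by decide), harr 9 (by decide) (by decide), h9] at c9
  have hsum : 0 ≤ ∑ q ∈ Finset.range (n * n), lossTwo (σ₂ 0) (σ₂ 6 0) q :=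
    Finset.sum_nonneg fun q hq => hz₀ q (Finset.mem_range.1 hq)
  have hlog : Nat.log 2 (σ₃ 8 0).toNat ≤ 3 * I + 2 := by
    have hq : ∀ q ∈ Finset.range (n * n), lossTwo (σ₂ 0) (σ₂ 6 0) q ≤ 2 ^ (2 * I + 1) := by
      intro q _
      unfold lossTwo
      have h₁ := (Int.natAbs_ediv_le_natAbs (σ₂ 6 0 * σ₂ 0 (9 * q + 8)) (σ₂ 0 (9 * q + 9))).trans (hmul _)
      have h₂ := (Int.natAbs_ediv_le_natAbs (σ₂ 6 0 * σ₂ 0 (9 * q + 4)) (σ₂ 0 (9 * q + 5))).trans (hmul _)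
      zify at h₁ h₂
      have h₁ := (abs_le.1 h₁).2
      have h₂ := (abs_le.1 h₂).1
      rw [pow_succ]
      linarith
    have hle := Finset.sum_le_sum hq
    rw [Finset.sum_const, Finset.card_range, nsmul_eq_mul] at hle
    have hnI : ((n * n : ℕ) : ℤ) ≤ 2 ^ I := by
      have := (show n * n ≤ I by omega).trans (Nat.lt_two_pow_self (n := I)).le
      exact_mod_cast this
    have hbound : σ₃ 8 0 ≤ 2 ^ (3 * I + 2) := by
      have e₁ : (2 : ℤ) ^ (3 * I + 2) = 2 ^ I * 2 ^ (2 * I + 1) + 2 ^ (3 * I + 1) := by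
        rw [← pow_add]; ring
      have e₂ : (1 : ℤ) ≤ 2 ^ (3 * I + 1) := one_le_pow₀ (by norm_num)
      have e₃ := mul_le_mul_of_nonneg_right hnI (by positivity : (0 : ℤ) ≤ 2 ^ (2 * I + 1))
      rw [c8]
      linarith
    have : (σ₃ 8 0).toNat ≤ 2 ^ (3 * I + 2) := by
      zify
      rw [Int.toNat_of_nonneg (by omega)]
      exact hbound
    exact (Nat.log_mono_right this).trans (Nat.log_pow (by norm_num) _).le
  -- The initial scale exceeds the cut around the source alone by one, so `q = 0` is admissible at
  -- the start.
  have hinv : MainInv n (cap (n + 2) σ₃)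
      (Nat.log 2 (σ₃ 8 0).toNat * (2 * ((n + 2) * (n + 2)) + 1) + 0 + 1) σ₃ := by
    refine ⟨by rw [c5, b 5 (by decide) (by decide), a5], by rw [c12, b 12 (by decide) (by decide), a12],
      by omega, ?_, hcap, ⟨0, fun S _ _ => (add_zero _).symm⟩,
      fun _ => ⟨0, fun u => decide (u = n), by simp, by simp, ?_, rfl⟩, fun h => by omega⟩
    · intro u _
      rw [c3, c9]; rfl
    · rw [hcut _ (by simp) (by simp), c8]
      have : ∀ q ∈ Finset.range (n * n), blockCut n (lossOne (σ₂ 0) (σ₂ 6 0)) (lossTwo (σ₂ 0) (σ₂ 6 0))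
          (fun u => decide (u = n)) q = lossTwo (σ₂ 0) (σ₂ 6 0) q := by
        intro q hq
        have : q / n ≠ n := (Nat.div_lt_of_lt_mul (Finset.mem_range.1 hq)).ne
        simp [blockCut, this]
      rw [Finset.sum_congr rfl this]
      push_cast
      linarith
  refine Wp.seq ((main_spec (B := 2 * I + 3) (by omega) hinv (Nat.mul_le_mul ?_ ?_)).mono le_rfl ?_)
    le_rfl
  · exact Nat.succ_le_succ (Nat.mul_le_mul hlog (by omega))
  · gcongr <;> omega
  rintro σ₄ ⟨d12, hs, ht, hmin⟩
  refine (result_spec (B := 2 * I + 3) d12 (show n ≤ I by omega)).mono le_rfl ?_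
  rintro σ₅ ⟨e1, hout⟩
  refine ⟨e1, σ₂ 6 0, sourceSide σ₄, hD, hdvd, hout, fun S => ?_⟩
  -- An arbitrary `S` is corrected at the source and the sink; the block sums look only at players
  -- and do not notice.
  have h := hmin (fun u => if u = n then true else if u = n + 1 then false else S u) (by simp) (by simp)
  rw [hcut _ hs ht, hcut _ (by simp) (by simp), b0] at h
  refine h.trans_eq (Finset.sum_congr rfl fun q hq => ?_)
  have hq := Finset.mem_range.1 hq
  have hn0 : 0 < n := Nat.pos_of_ne_zero (by rintro rfl; simp at hq)
  have h₁ : q / n < n := Nat.div_lt_of_lt_mul hq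
  have h₂ : q % n < n := Nat.mod_lt _ hn0
  simp only [blockCut, if_neg h₁.ne, if_neg h₂.ne, if_neg (show q / n ≠ n + 1 by omega),
    if_neg (show q % n ≠ n + 1 by omega)]

/-- A bound for the cost of a program of the given size and weight on inputs of size `I`. -/
def costBound (s g I : ℕ) : ℕ :=
  (iterationBound I + 1) * s * (2 ^ g * (2 * I + 3 + g * ((iterationBound I + 1) * s) + g + 2) + 1)

theorem exists_polynomial_costBound (s g : ℕ) :
    ∃ P : Polynomial ℕ, ∀ I, costBound s g I = P.eval I := by
  let X : Polynomial ℕ := Polynomial.X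
  let K : Polynomial ℕ :=
    X + (X + (((3 * X + 2) * (2 * (X + 3) + 1) + 1) * ((X + 3) * (X + 3 + 1) + (X + 2) + 1) + X))
  refine ⟨(K + 1) * (s : Polynomial ℕ) * (2 ^ g *
    (2 * X + 3 + (g : Polynomial ℕ) * ((K + 1) * (s : Polynomial ℕ)) + (g : Polynomial ℕ) + 2) + 1),
    fun I => ?_⟩
  simp [K, X, costBound, iterationBound]

end MinCut

end ArrayRAM

/-! ### Potentials and cuts -/

theorem eq_of_update_eq {ι α β : Type*} [Fintype ι] [DecidableEq ι] (g : (ι → α) → β)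
    (h : ∀ s i a a', g (Function.update s i a) = g (Function.update s i a')) (s s' : ι → α) :
    g s = g s' := by
  have key : ∀ T : Finset ι, g (T.piecewise s' s) = g s := by
    intro T
    induction T using Finset.induction_on with
    | empty => rw [Finset.piecewise_empty]
    | insert i T _ ih =>
      -- The inserted value is exchanged for the value already present at `i`, which makes the
      -- update trivial.
      rw [Finset.piecewise_insert, h _ _ _ ((T.piecewise s' s) i), Function.update_eq_self, ih]
  have := key Finset.univ
  rw [Finset.piecewise_univ] at this
  exact this.symm

/-- Only row `i` and column `i` depend on the new value. The vanishing diagonal keeps their common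
entry from being counted twice. -/
theorem sum_sum_update_sub {n : ℕ} {α : Type*} (f : Fin n → Fin n → α → α → ℝ)
    (hf : ∀ i a b, f i i a b = 0) (s : Fin n → α) (i : Fin n) (a a' : α) :
    (∑ k, ∑ l, f k l (Function.update s i a k) (Function.update s i a l)) -
      (∑ k, ∑ l, f k l (Function.update s i a' k) (Function.update s i a' l)) =
      ∑ l, (f i l a (s l) + f l i (s l) a - f i l a' (s l) - f l i (s l) a') := by
  have key : ∀ a, ∑ k, ∑ l, f k l (Function.update s i a k) (Function.update s i a l) =
      ∑ l, (f i l a (s l) + f l i (s l) a) +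
        ∑ k, ∑ l, if k = i ∨ l = i then 0 else f k l (s k) (s l) := by
    intro a
    have h₁ : ∀ k l, f k l (Function.update s i a k) (Function.update s i a l) =
        (if k = i then f i l a (s l) else 0) + (if l = i then f k i (s k) a else 0) +
          if k = i ∨ l = i then 0 else f k l (s k) (s l) := by
      intro k l
      by_cases hk : k = i
      · subst hk
        by_cases hl : l = k
        · subst hl; simp [hf]
        · simp [hl]
      · by_cases hl : l = i
        · subst hl; simp [hk]
        · simp [hk, hl]
    simp only [h₁, Finset.sum_add_distrib]
    congr 2
    · rw [Finset.sum_eq_single i (by intro k _ hk; simp [hk]) (by simp)]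
      simp
    · simp
  rw [key a, key a']
  simp only [Finset.sum_add_distrib, Finset.sum_sub_distrib]
  ring

namespace BinaryPolymatrixGame

variable (G : BinaryPolymatrixGame)

open Classical in
/-- The payoff matrix of an ordered pair of players, which is zero if the pair is not an edge. -/
noncomputable def edgePayoff (i j : Fin G.n) : Matrix (Fin 2) (Fin 2) ℚ :=
  if G.graph.Adj i j then G.payoff i j else 0

theorem edgePayoff_self (i : Fin G.n) : G.edgePayoff i i = 0 := if_neg (SimpleGraph.irrefl _)

theorem totalPayoff_update (i : Fin G.n) (s : G.Profile) (a : Fin 2) :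
    G.totalPayoff i (Function.update s i a) = ∑ j, G.edgePayoff i j a (s j) := by
  refine Finset.sum_congr rfl fun j _ => ?_
  unfold edgePayoff
  split_ifs with h
  · rw [Function.update_self, Function.update_of_ne h.ne']
  · rfl

/-- What player `i` loses in the interaction with `j` by the deviation from `(1, 1)`. -/
noncomputable def lossOne (i j : Fin G.n) : ℚ := G.edgePayoff i j 0 0 - G.edgePayoff i j 1 0

/-- What player `i` loses in the interaction with `j` by the deviation from `(2, 2)`. -/
noncomputable def lossTwo (i j : Fin G.n) : ℚ := G.edgePayoff i j 1 1 - G.edgePayoff i j 0 1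

variable {G}

theorem IsPureCoordination.lossOne_nonneg (h : G.IsPureCoordination) (i j : Fin G.n) :
    0 ≤ G.lossOne i j := by
  unfold lossOne edgePayoff
  split_ifs with hij
  · have := (h i j hij).1.1 1; linarith
  · simp

theorem IsPureCoordination.lossTwo_nonneg (h : G.IsPureCoordination) (i j : Fin G.n) :
    0 ≤ G.lossTwo i j := by
  unfold lossTwo edgePayoff
  split_ifs with hij
  · have := (h i j hij).2.1 0; linarith
  · simp

/-- Both sides equal the alternating sum of the entries of `φ`, expressed once through the
differences of one player and once through those of the other. -/
theorem IsPairwisePotential.loss_symm (h : G.IsPairwisePotential) (i j : Fin G.n) :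
    G.lossOne i j + G.lossTwo i j = G.lossOne j i + G.lossTwo j i := by
  unfold lossOne lossTwo edgePayoff
  by_cases hij : G.graph.Adj i j
  · rw [if_pos hij, if_pos hij.symm]
    obtain ⟨φ, h₁, h₂⟩ := h i j hij
    have a₁ := h₁ 0 1 0
    have a₂ := h₁ 1 0 1
    have b₁ := h₂ 0 0 1
    have b₂ := h₂ 1 1 0
    have : ((G.payoff i j 0 0 - G.payoff i j 1 0 + (G.payoff i j 1 1 - G.payoff i j 0 1) : ℚ) : ℝ) =
        ((G.payoff j i 0 0 - G.payoff j i 1 0 + (G.payoff j i 1 1 - G.payoff j i 0 1) : ℚ) : ℝ) := by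
      push_cast
      linarith
    exact_mod_cast this
  · rw [if_neg hij, if_neg fun h => hij h.symm]

/-- The contribution of an ordered pair of players to the capacity of a cut. -/
noncomputable def pairCut (G : BinaryPolymatrixGame) (D : ℝ) (i j : Fin G.n) (a b : Fin 2) : ℝ :=
  (if a = 1 ∧ b = 0 then D * G.lossOne i j + D * G.lossTwo i j else 0) +
    (if a = 1 then D * G.lossOne i j else 0) + (if a = 0 then D * G.lossTwo i j else 0)

/-- It suffices to let one player `i` switch from action one to two. Against a neighbour with action
one the two ordered pairs change by `2Dy` in total. Against action two they change by `D(y - z - y'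
- z')`, with primes for the reversed pair, and `y' + z' = y + z` turns this into `-2Dz`. In both
cases this is `-2D` times the payoff change. -/
theorem IsPotential.cut_eq (hP : G.IsPairwisePotential) {Φ : G.Profile → ℝ} (hΦ : G.IsPotential Φ)
    (D : ℝ) (s s' : G.Profile) :
    2 * D * Φ s + ∑ i, ∑ j, G.pairCut D i j (s i) (s j) =
      2 * D * Φ s' + ∑ i, ∑ j, G.pairCut D i j (s' i) (s' j) := by
  refine eq_of_update_eq (fun s => 2 * D * Φ s + ∑ i, ∑ j, G.pairCut D i j (s i) (s j)) ?_ s s'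
  intro s i a a'
  have h₁ := hΦ i s a a'
  have h₂ := sum_sum_update_sub (G.pairCut D) (fun i a b => by
    simp [pairCut, lossOne, lossTwo, edgePayoff_self]) s i a a'
  rw [totalPayoff_update, totalPayoff_update] at h₁
  have h₃ : ∑ l, (G.pairCut D i l a (s l) + G.pairCut D l i (s l) a - G.pairCut D i l a' (s l) -
      G.pairCut D l i (s l) a') =
      -(2 * D * (((∑ j, G.edgePayoff i j a (s j) : ℚ) : ℝ) -
        ((∑ j, G.edgePayoff i j a' (s j) : ℚ) : ℝ))) := by
    push_cast
    rw [← Finset.sum_sub_distrib, Finset.mul_sum, ← Finset.sum_neg_distrib]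
    refine Finset.sum_congr rfl fun l _ => ?_
    have hsym : ((G.lossOne i l + G.lossTwo i l : ℚ) : ℝ) = ((G.lossOne l i + G.lossTwo l i : ℚ) : ℝ) := by
      rw [hP.loss_symm i l]
    have hsym' : D * G.lossOne l i = D * G.lossOne i l + D * G.lossTwo i l - D * G.lossTwo l i := by
      push_cast at hsym
      have : (G.lossOne l i : ℝ) = G.lossOne i l + G.lossTwo i l - G.lossTwo l i := by linarith
      rw [this]; ring
    have e₁ : (G.lossOne i l : ℝ) = G.edgePayoff i l 0 0 - G.edgePayoff i l 1 0 := by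
      unfold lossOne; push_cast; rfl
    have e₂ : (G.lossTwo i l : ℝ) = G.edgePayoff i l 1 1 - G.edgePayoff i l 0 1 := by
      unfold lossTwo; push_cast; rfl
    generalize s l = b
    fin_cases a <;> fin_cases a' <;> fin_cases b <;> simp [pairCut, hsym', e₁, e₂] <;> ring
  linear_combination 2 * D * h₁ + h₂ + h₃

/-- Each edge at the deviating player occurs once in the sum; depending on the order of the
endpoints, the row or the column condition of its potential applies. -/
theorem IsPotentialFamily.isPotential {φ : Fin G.n → Fin G.n → Matrix (Fin 2) (Fin 2) ℝ}
    (h : G.IsPotentialFamily φ) : G.IsPotential (G.potentialSum φ) := by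
  classical
  intro i s a a'
  have h₂ := sum_sum_update_sub (fun k l a b => if k < l ∧ G.graph.Adj k l then φ k l a b else 0)
    (fun i a b => by simp) s i a a'
  rw [totalPayoff_update, totalPayoff_update]
  refine (Eq.trans ?_ h₂).trans ?_
  · unfold potentialSum
    congr!
  push_cast
  rw [← Finset.sum_sub_distrib]
  refine Finset.sum_congr rfl fun l _ => ?_
  unfold edgePayoff
  by_cases hil : G.graph.Adj i l
  · rw [if_pos hil]
    rcases lt_or_gt_of_ne hil.ne with hlt | hlt
    · have := (h i l hlt hil).1 a a' (s l)
      simp only [hlt, hil, hlt.not_gt, true_and, false_and, if_true, if_false]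
      linarith
    · have := (h l i hlt hil.symm).2 (s l) a a'
      simp only [hlt, hil.symm, hlt.not_gt, true_and, false_and, if_true, if_false]
      linarith
  · have hli : ¬ G.graph.Adj l i := fun h => hil h.symm
    simp [hil, hli]

end BinaryPolymatrixGame

/-! ### Indexing and summation in lists of equal blocks -/

theorem List.length_flatMap_of_length_eq {α β : Type*} {f : α → List β} {m : ℕ}
    (hf : ∀ a, (f a).length = m) (l : List α) : (l.flatMap f).length = l.length * m := by
  induction l with
  | nil => simp
  | cons a l ih => rw [List.flatMap_cons, List.length_append, ih, hf, List.length_cons]; ring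

theorem List.getD_flatMap {α β : Type*} {f : α → List β} {m : ℕ} (hf : ∀ a, (f a).length = m)
    (d : β) {r : ℕ} (hr : r < m) (l : List α) (k : ℕ) (hk : k < l.length) :
    (l.flatMap f).getD (k * m + r) d = (f l[k]).getD r d := by
  induction l generalizing k with
  | nil => simp at hk
  | cons a l ih =>
    rw [List.flatMap_cons]
    cases k with
    | zero =>
      rw [List.getD_append _ _ _ _ (by rw [hf]; omega)]
      simp
    | succ k =>
      rw [List.getD_append_right _ _ _ _ (by rw [hf]; nlinarith), hf,
        show (k + 1) * m + r - m = k * m + r by rw [Nat.succ_mul]; omega,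
        ih k (by simpa using hk)]
      simp

theorem List.sum_range_getD {α : Type*} (l : List α) (f : α → ℕ) (d : α) :
    ∑ k ∈ Finset.range l.length, f (l.getD k d) = (l.map f).sum := by
  induction l with
  | nil => simp
  | cons a l ih => simp [Finset.sum_range_succ', ← ih, add_comm]

theorem sum_range_mul {M : Type*} [AddCommMonoid M] (g : ℕ → M) (m n : ℕ) :
    ∑ q ∈ Finset.range (m * n), g q = ∑ i : Fin m, ∑ j : Fin n, g (i * n + j) := by
  rw [← Finset.sum_range fun i => ∑ j : Fin n, g (i * n + j)]
  induction m with
  | zero => simp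
  | succ m ih =>
    rw [Nat.succ_mul, Finset.sum_range_add, ih, Finset.sum_range_succ,
      ← Finset.sum_range fun j => g (m * n + j)]

/-! ### Input size and cost bound -/

namespace ArrayRAM

theorem length_le_inputSize (l : List ℤ) : l.length ≤ inputSize l := by
  unfold inputSize
  induction l with
  | nil => simp
  | cons a l ih =>
    simp only [List.length_cons, List.map_cons, List.sum_cons, bitLength]
    omega

theorem natAbs_getD_le (l : List ℤ) (k : ℕ) : (l.getD k 0).natAbs ≤ 2 ^ inputSize l := by
  by_cases hk : k < l.length
  · refine (natAbs_lt_two_pow_bitLength _).le.trans (Nat.pow_le_pow_right (by norm_num) ?_)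
    unfold inputSize
    rw [← List.sum_range_getD l bitLength 0]
    exact Finset.single_le_sum (f := fun k => bitLength (l.getD k 0)) (fun _ _ => Nat.zero_le _)
      (Finset.mem_range.2 hk)
  · rw [List.getD_eq_default _ _ (not_lt.1 hk)]
    exact Nat.zero_le _

theorem initial_bounded (l : List ℤ) : (initial l).Bounded (inputSize l) := by
  intro a i
  unfold initial
  split_ifs
  · exact natAbs_getD_le l _
  · rw [Int.natAbs_natCast]
    exact (length_le_inputSize l).trans Nat.lt_two_pow_self.le
  · simp

theorem initial_zero_natCast (l : List ℤ) (k : ℕ) : initial l 0 k = l.getD k 0 := by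
  simp [initial]

theorem initial_of_two_le (l : List ℤ) {a : ℕ} (ha : 2 ≤ a) : initial l a = 0 := by
  funext i
  simp [initial, show a ≠ 0 by omega, show a ≠ 1 by omega]

/-- The weight `w` of the program can serve as the exponent `g` because `w ≤ 2 ^ w`, and the bound
for products also bounds the initial memory. -/
theorem Wp.exists_computes {I k : ℕ} {c : Program} {l : List ℤ} {Q : Memory → Prop}
    (h : Wp (2 * I + 3) c k Q (initial l)) (hI : inputSize l ≤ I) :
    ∃ σ t, Exec c (initial l) t σ ∧ t ≤ (k + 1) * c.size *
      (2 ^ c.weight * (2 * I + 3 + c.weight * ((k + 1) * c.size) + c.weight + 2) + 1) ∧ Q σ := by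
  obtain ⟨σ, k', hk', hr, hQ⟩ := h
  obtain ⟨m, t, hm, he, ht, -⟩ := hr.exists_exec (g := c.weight) (L := 2 * I + 3)
    Nat.lt_two_pow_self.le ((initial_bounded l).mono (by omega)) le_rfl
  have hm' : m ≤ (k + 1) * c.size := hm.trans (Nat.mul_le_mul_right _ (by omega))
  refine ⟨σ, t, he, ht.trans (Nat.mul_le_mul hm' ?_), hQ⟩
  exact stepBound_mono _ (Nat.add_le_add_left (Nat.mul_le_mul_left _ hm') _)

end ArrayRAM

/-! ### Reading the game off the input list -/

namespace BinaryPolymatrixGame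

open ArrayRAM

variable (G : BinaryPolymatrixGame)

open Classical in
/-- The part of the input that belongs to an ordered pair of players. -/
noncomputable def encodePair (i j : Fin G.n) : List ℤ :=
  (if G.graph.Adj i j then 1 else 0) :: encodeMatrix (G.edgePayoff i j)

theorem encode_eq : G.encode = (G.n : ℤ) :: (List.finRange G.n).flatMap fun i =>
    (List.finRange G.n).flatMap fun j => G.encodePair i j := by
  unfold encode encodePair edgePayoff
  congr! 5
  split_ifs <;> rfl

theorem length_encode : G.encode.length = 9 * (G.n * G.n) + 1 := by
  rw [encode_eq, List.length_cons, List.length_flatMap_of_length_eq (m := G.n * 9)]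
  · rw [List.length_finRange]; ring
  · intro i
    rw [List.length_flatMap_of_length_eq (m := 9) fun _ => rfl, List.length_finRange]

theorem encode_getD (i j : Fin G.n) {r : ℕ} (hr : r < 9) :
    G.encode.getD (9 * ((i : ℕ) * G.n + j) + (r + 1)) 0 = (G.encodePair i j).getD r 0 := by
  have hj : (j : ℕ) * 9 + r < G.n * 9 := by have := j.2; omega
  rw [encode_eq, ← add_assoc, List.getD_cons_succ,
    show 9 * ((i : ℕ) * G.n + j) + r = i * (G.n * 9) + (j * 9 + r) by ring,
    List.getD_flatMap (m := G.n * 9) _ _ hj _ _ (by simp),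
    List.getD_flatMap (m := 9) (fun _ => rfl) _ hr _ _ (by simp)]
  · simp
  · intro i
    rw [List.length_flatMap_of_length_eq (m := 9) fun _ => rfl, List.length_finRange]

theorem initial_encode (i j : Fin G.n) {q r : ℕ} (hq : q = (i : ℕ) * G.n + j) (hr : r < 9) :
    initial G.encode 0 (9 * (q : ℤ) + (r + 1 : ℕ)) = (G.encodePair i j).getD r 0 := by
  rw [← G.encode_getD i j hr, ← hq, ← initial_zero_natCast]
  push_cast
  rfl

theorem initial_encode_payoff (i j : Fin G.n) {q : ℕ} (hq : q = (i : ℕ) * G.n + j) :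
    initial G.encode 0 (9 * q + 2) = (G.edgePayoff i j 0 0).num ∧
    initial G.encode 0 (9 * q + 3) = (G.edgePayoff i j 0 0).den ∧
    initial G.encode 0 (9 * q + 4) = (G.edgePayoff i j 0 1).num ∧
    initial G.encode 0 (9 * q + 5) = (G.edgePayoff i j 0 1).den ∧
    initial G.encode 0 (9 * q + 6) = (G.edgePayoff i j 1 0).num ∧
    initial G.encode 0 (9 * q + 7) = (G.edgePayoff i j 1 0).den ∧
    initial G.encode 0 (9 * q + 8) = (G.edgePayoff i j 1 1).num ∧
    initial G.encode 0 (9 * q + 9) = (G.edgePayoff i j 1 1).den :=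
  ⟨G.initial_encode i j (r := 1) hq (by norm_num), G.initial_encode i j (r := 2) hq (by norm_num),
    G.initial_encode i j (r := 3) hq (by norm_num), G.initial_encode i j (r := 4) hq (by norm_num),
    G.initial_encode i j (r := 5) hq (by norm_num), G.initial_encode i j (r := 6) hq (by norm_num),
    G.initial_encode i j (r := 7) hq (by norm_num), G.initial_encode i j (r := 8) hq (by norm_num)⟩

theorem cast_mul_num_ediv_den {D : ℤ} {q : ℚ} (h : (q.den : ℤ) ∣ D) :
    ((D * q.num / q.den : ℤ) : ℚ) = D * q := by
  rw [Int.cast_div (h.mul_right _) (by exact_mod_cast q.den_ne_zero)]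
  push_cast
  rw [mul_div_assoc, Rat.num_div_den]

/-- Every denominator of the block divides `D`, so the integer divisions of the program are exact.
-/
theorem cast_losses {D : ℤ} (i j : Fin G.n) {q : ℕ} (hq : q = (i : ℕ) * G.n + j)
    (h : MinCut.blockDen (initial G.encode 0) q ∣ D) :
    ((MinCut.lossOne (initial G.encode 0) D q : ℤ) : ℚ) = D * G.lossOne i j ∧
    ((MinCut.lossTwo (initial G.encode 0) D q : ℤ) : ℚ) = D * G.lossTwo i j := by
  obtain ⟨e₂, e₃, e₄, e₅, e₆, e₇, e₈, e₉⟩ := G.initial_encode_payoff i j hq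
  unfold MinCut.blockDen at h
  rw [e₃, e₅, e₇, e₉] at h
  have d₉ := (Dvd.intro_left _ rfl).trans h
  have h := (Dvd.intro _ rfl).trans h
  have d₇ := (Dvd.intro_left _ rfl).trans h
  have h := (Dvd.intro _ rfl).trans h
  have d₅ := (Dvd.intro_left _ rfl).trans h
  have d₃ := (Dvd.intro _ rfl).trans h
  unfold MinCut.lossOne MinCut.lossTwo lossOne lossTwo
  rw [e₂, e₃, e₄, e₅, e₆, e₇, e₈, e₉]
  constructor
  · rw [Int.cast_sub, cast_mul_num_ediv_den d₃, cast_mul_num_ediv_den d₇, mul_sub]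
  · rw [Int.cast_sub, cast_mul_num_ediv_den d₉, cast_mul_num_ediv_den d₅, mul_sub]

/-- The set of the players with the second action. -/
def playersTwo (s : G.Profile) (u : ℕ) : Bool := if h : u < G.n then decide (s ⟨u, h⟩ = 1) else false

theorem playersTwo_val (s : G.Profile) (i : Fin G.n) : G.playersTwo s i = decide (s i = 1) := by
  simp [playersTwo]

theorem cast_sum_blockCut {D : ℤ} (s : G.Profile) (S : ℕ → Bool)
    (hS : ∀ i : Fin G.n, S i = decide (s i = 1))
    (h : ∀ q < G.n * G.n, MinCut.blockDen (initial G.encode 0) q ∣ D) :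
    ((∑ q ∈ Finset.range (G.n * G.n), MinCut.blockCut G.n (MinCut.lossOne (initial G.encode 0) D)
      (MinCut.lossTwo (initial G.encode 0) D) S q : ℤ) : ℝ) =
      ∑ i, ∑ j, G.pairCut D i j (s i) (s j) := by
  rw [sum_range_mul]
  push_cast
  refine Finset.sum_congr rfl fun i _ => Finset.sum_congr rfl fun j _ => ?_
  have hn : 0 < G.n := (Nat.zero_le _).trans_lt i.2
  have hlt : (i : ℕ) * G.n + j < G.n * G.n := by have := i.2; have := j.2; nlinarith
  obtain ⟨h₁, h₂⟩ := G.cast_losses i j rfl (h _ hlt)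
  have h₁ : (MinCut.lossOne (initial G.encode 0) D ((i : ℕ) * G.n + j) : ℝ) = D * G.lossOne i j := by
    exact_mod_cast congrArg (Rat.cast : ℚ → ℝ) h₁
  have h₂ : (MinCut.lossTwo (initial G.encode 0) D ((i : ℕ) * G.n + j) : ℝ) = D * G.lossTwo i j := by
    exact_mod_cast congrArg (Rat.cast : ℚ → ℝ) h₂
  have hdiv : ((i : ℕ) * G.n + j) / G.n = i := by
    rw [add_comm, Nat.add_mul_div_right _ _ hn, Nat.div_eq_of_lt j.2, zero_add]
  have hmod : ((i : ℕ) * G.n + j) % G.n = j := by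
    rw [add_comm, Nat.add_mul_mod_self_right, Nat.mod_eq_of_lt j.2]
  unfold MinCut.blockCut pairCut
  rw [hdiv, hmod, hS, hS]
  push_cast
  rw [h₁, h₂]
  have two : ∀ a : Fin 2, ¬ a = 1 ↔ a = 0 := by decide
  simp only [decide_eq_true_eq, decide_eq_false_iff_not, two]

theorem sum_bitLength_le {m : ℕ} (l : List ℤ) (hm : m ≤ l.length) :
    ∑ k ∈ Finset.range m, bitLength (l.getD k 0) ≤ inputSize l := by
  unfold inputSize
  rw [← List.sum_range_getD l bitLength 0]
  exact Finset.sum_le_sum_of_subset (Finset.range_subset_range.2 hm)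

/-- Pure coordination enters as nonnegativity of the capacities. The source side of the cut becomes
the set of players with action two. -/
theorem exists_profile_of_program (hc : G.IsPureCoordination) :
    ∃ (s : G.Profile) (t : ℕ) (D : ℤ), 0 < D ∧
      Computes MinCut.program G.encode t (G.encodeProfile s) ∧
      t ≤ MinCut.costBound MinCut.program.size MinCut.program.weight (inputSize G.encode) ∧
      ∀ s' : G.Profile, ∑ i, ∑ j, G.pairCut D i j (s i) (s j) ≤
        ∑ i, ∑ j, G.pairCut D i j (s' i) (s' j) := by
  have hpair : ∀ q < G.n * G.n, ∃ i j : Fin G.n, q = (i : ℕ) * G.n + j := by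
    intro q hq
    have hn : 0 < G.n := Nat.pos_of_ne_zero (by intro h; simp [h] at hq)
    exact ⟨⟨q / G.n, Nat.div_lt_of_lt_mul hq⟩, ⟨q % G.n, Nat.mod_lt _ hn⟩, (Nat.div_add_mod' _ _).symm⟩
  have hden : ∀ q < G.n * G.n, 0 < initial G.encode 0 (9 * q + 3) ∧
      0 < initial G.encode 0 (9 * q + 5) ∧ 0 < initial G.encode 0 (9 * q + 7) ∧
      0 < initial G.encode 0 (9 * q + 9) := by
    intro q hq
    obtain ⟨i, j, hq⟩ := hpair q hq
    obtain ⟨-, e₃, -, e₅, -, e₇, -, e₉⟩ := G.initial_encode_payoff i j hq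
    rw [e₃, e₅, e₇, e₉]
    exact ⟨by exact_mod_cast Rat.den_pos _, by exact_mod_cast Rat.den_pos _,
      by exact_mod_cast Rat.den_pos _, by exact_mod_cast Rat.den_pos _⟩
  have hspec := MinCut.program_spec (I := inputSize G.encode) (n := G.n) (σ₀ := initial G.encode)
    (G.length_encode ▸ length_le_inputSize G.encode)
    (by simp [initial, encode_eq])
    (initial_of_two_le _ (by norm_num)) (initial_of_two_le _ (by norm_num))
    (initial_of_two_le _ (by norm_num)) (fun i => initial_bounded _ 0 i)
    -- The bits of the number of players and of the first `q` blocks.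
    (fun q => ∑ k ∈ Finset.range (9 * q + 1), bitLength (G.encode.getD k 0))
    (fun q hq => sum_bitLength_le _ (by rw [length_encode]; omega)) hden ?_ ?_
  · obtain ⟨σ, t, hex, ht, h1, D, U, hD, hdvd, hout, hmin⟩ := hspec.exists_computes le_rfl
    refine ⟨fun i => if U i then 1 else 0, t, D, hD, ⟨σ, hex, ?_⟩, ht, fun s' => ?_⟩
    · unfold output encodeProfile
      rw [h1, Int.toNat_natCast]
      refine List.ext_getElem (by simp) fun k hk _ => ?_
      have hk : k < G.n := by simpa using hk
      simp only [List.getElem_map, List.getElem_range, List.getElem_ofFn, hout k hk]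
      split_ifs <;> rfl
    · rw [← G.cast_sum_blockCut _ U (fun i => by by_cases h : U i = true <;> simp [h]) hdvd,
        ← G.cast_sum_blockCut s' (G.playersTwo s') (G.playersTwo_val s') hdvd]
      exact_mod_cast hmin _
  · intro q hq
    have hle : ∀ r : ℕ, initial G.encode 0 (9 * q + (r + 1 : ℕ)) ≤
        2 ^ bitLength (G.encode.getD (9 * q + 1 + r) 0) := by
      intro r
      have e : 9 * (q : ℤ) + (r + 1 : ℕ) = (9 * q + 1 + r : ℕ) := by push_cast; ring
      rw [e, initial_zero_natCast]
      refine Int.le_natAbs.trans ?_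
      exact_mod_cast (natAbs_lt_two_pow_bitLength _).le
    obtain ⟨d₁, d₂, d₃, d₄⟩ := hden q hq
    -- Block `q` starts at position `9 * q + 1` with its adjacency entry; the denominators have
    -- offsets 2, 4, 6 and 8.
    have hsum : ∑ k ∈ Finset.range (9 * (q + 1) + 1), bitLength (G.encode.getD k 0) ≥
        ∑ k ∈ Finset.range (9 * q + 1), bitLength (G.encode.getD k 0) +
        (bitLength (G.encode.getD (9 * q + 1 + 2) 0) + bitLength (G.encode.getD (9 * q + 1 + 4) 0) +
        bitLength (G.encode.getD (9 * q + 1 + 6) 0) + bitLength (G.encode.getD (9 * q + 1 + 8) 0)) := by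
      rw [show 9 * (q + 1) + 1 = 9 * q + 1 + 9 by ring, Finset.sum_range_add]
      simp only [Finset.sum_range_succ, Finset.sum_range_zero]
      omega
    refine le_trans ?_ (pow_le_pow_right₀ (by norm_num) hsum)
    rw [pow_add, pow_add, pow_add, pow_add]
    refine mul_le_mul_of_nonneg_left ?_ (by positivity)
    unfold MinCut.blockDen
    have l₁ := hle 2
    have l₂ := hle 4
    have l₃ := hle 6
    have l₄ := hle 8
    push_cast at l₁ l₂ l₃ l₄
    gcongr
  · intro D hD q hq hdvd
    obtain ⟨i, j, hq⟩ := hpair q hq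
    obtain ⟨h₁, h₂⟩ := G.cast_losses i j hq hdvd
    have hD : (0 : ℚ) ≤ D := by exact_mod_cast hD.le
    have h₁ := h₁.symm.le.trans' (mul_nonneg hD (hc.lossOne_nonneg i j))
    have h₂ := h₂.symm.le.trans' (mul_nonneg hD (hc.lossTwo_nonneg i j))
    exact ⟨by exact_mod_cast h₁, by exact_mod_cast h₂⟩

end BinaryPolymatrixGame

theorem corollary3 :
    ∃ (prog : ArrayRAM.Program) (P : Polynomial ℕ),
      ∀ G : BinaryPolymatrixGame, G.IsPureCoordination → G.IsPairwisePotential →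
        ∃ (s : G.Profile) (t : ℕ),
          ArrayRAM.Computes prog G.encode t (G.encodeProfile s) ∧
          t ≤ P.eval (ArrayRAM.inputSize G.encode) ∧
          (∀ φ, G.IsPotentialFamily φ → ∀ s', G.potentialSum φ s' ≤ G.potentialSum φ s) ∧
          (∀ Φ, G.IsPotential Φ → ∀ s', Φ s' ≤ Φ s) := by
  obtain ⟨P, hP⟩ := ArrayRAM.MinCut.exists_polynomial_costBound ArrayRAM.MinCut.program.size
    ArrayRAM.MinCut.program.weight
  refine ⟨ArrayRAM.MinCut.program, P, fun G hc hp => ?_⟩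
  obtain ⟨s, t, D, hD, hcomp, ht, hmin⟩ := G.exists_profile_of_program hc
  have hmax : ∀ Φ, G.IsPotential Φ → ∀ s', Φ s' ≤ Φ s := by
    intro Φ hΦ s'
    have h := hΦ.cut_eq hp D s s'
    have := hmin s'
    have hD : (0 : ℝ) < D := by exact_mod_cast hD
    exact le_of_mul_le_mul_left (by linarith) (by linarith : (0 : ℝ) < 2 * D)
  exact ⟨s, t, hcomp, hP _ ▸ ht, fun φ hφ => hmax _ hφ.isPotential, hmax⟩
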